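/- Let $k\ge 2$ be an integer. For a finite simple graph $F$, a $k$-uniform hypergraph $H$ (a finite vertex set with a set of $k$-element subsets, called hyperedges) is \emph{Berge-$F$} if $F$ can be embedded injectively on the vertex set of $H$ so that there is a bijection $\phi:E(F)\to E(H)$ with $e\subseteq\phi(e)$ for every $e\in E(F)$; the hyperedges may use further vertices. A $k$-uniform hypergraph $H$ is \emph{Berge-$F$-saturated} if no subhypergraph of $H$ is Berge-$F$, but for every $k$-element set $e\subseteq V(H)$ with $e\notin E(H)$, the hypergraph $H+e$ has a Berge-$F$ subhypergraph. Let $\mathrm{sat}_k(n,\text{Berge-}F)$ be the minimum number of hyperedges in a Berge-$F$-saturated $k$-uniform hypergraph on $n$ vertices. \textbf{Theorem.} Let $F$ be a finite simple graph with at least one edge and let $k\in\{3,4,5\}$. Then for every $n$ there is a Berge-$F$-saturated $k$-uniform hypergraph on $n$ vertices, and $$\mathrm{sat}_k(n,\text{Berge-}F)=O(n)\qquad (n\to\infty),$$ where the implied constant depends only on $F$ and $k$. -/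

import Mathlib

open Filter Asymptotics

/-- A `k`-uniform hypergraph with vertex set `V`, given by its finite set of hyperedges. -/
@[ext]
structure UniformHypergraph (k : ℕ) (V : Type*) where
  edges : Finset (Finset V)
  uniform : ∀ e ∈ edges, e.card = k

namespace UniformHypergraph

variable {k : ℕ} {V W : Type*}

/-- `H'` is a subhypergraph of `H` (on the same vertex set): each hyperedge of `H'` is one of `H`. -/
def IsSubhypergraph (H' H : UniformHypergraph k V) : Prop :=
  H'.edges ⊆ H.edges

/-- The hypergraph `H + e` obtained from `H` by adding the `k`-edge `e`. -/
def addEdge [DecidableEq V] (H : UniformHypergraph k V) (e : Finset V) (he : e.card = k) :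
    UniformHypergraph k V where
  edges := insert e H.edges
  uniform := by
    intro f hf
    rcases Finset.mem_insert.mp hf with rfl | hf
    · exact he
    · exact H.uniform f hf

/-- `H` is Berge-`F`: the graph `F` can be embedded on the vertex set of `H` (by an injection `f`)
so that some bijection `φ` from the edges of `F` to the hyperedges of `H` sends each edge of `F` to
a hyperedge containing both (embedded) endpoints. The hyperedges may use further vertices. -/
def IsBerge (F : SimpleGraph W) (H : UniformHypergraph k V) : Prop :=
  ∃ (f : W ↪ V) (φ : F.edgeSet ≃ H.edges), ∀ (e : F.edgeSet) (w : W),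
    w ∈ (e : Sym2 W) → f w ∈ (φ e : Finset V)

/-- `H` contains a copy of a Berge-`F`. -/
def ContainsBerge (F : SimpleGraph W) (H : UniformHypergraph k V) : Prop :=
  ∃ H' : UniformHypergraph k V, H'.IsSubhypergraph H ∧ H'.IsBerge F

/-- `H` is Berge-`F`-saturated: `H` contains no Berge-`F`, but adding any new `k`-edge on the
vertex set of `H` creates a Berge-`F`. -/
def IsBergeSaturated [DecidableEq V] (F : SimpleGraph W) (H : UniformHypergraph k V) : Prop :=
  ¬ H.ContainsBerge F ∧
    ∀ (e : Finset V) (he : e.card = k), e ∉ H.edges → (H.addEdge e he).ContainsBerge F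

end UniformHypergraph

/-- The saturation number `sat_k(n, Berge-F)`: the minimum number of hyperedges of a
Berge-`F`-saturated `k`-uniform hypergraph on `n` vertices. (It is `0` by convention if there is no
such hypergraph.) -/
noncomputable def bergeSat {W : Type*} (k n : ℕ) (F : SimpleGraph W) : ℕ :=
  sInf {m : ℕ | ∃ H : UniformHypergraph k (Fin n), H.IsBergeSaturated F ∧ H.edges.card = m}

/-! ### Berge copies as injective maps, and saturated extensions -/

namespace UniformHypergraph

variable {k : ℕ} {V W : Type*}

/-! A Berge-`F`-free hypergraph on a finite vertex set extends to a saturated one, so for large `n`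
it suffices to find a Berge-`F`-free seed all of whose Berge-`F`-free extensions have O(n)
hyperedges. If `F` is a forest, the empty seed works. Otherwise the seed is `petalHypergraph`: `t`
core vertices, disjoint petals of size `s` covering all but boundedly many vertices, every union of
a petal with one of `q` fixed core subsets (kernels), and for each core pair a hyperedge filled up
with private vertices.

Extensions are sparse (`card_edges_le_of_petalHypergraph_le`). Let `A` be a set whose deletion
leaves a forest. With too many hyperedges there is a dense part outside the core
(`exists_dense_subset`), where the forest embeds greedily, one vertex per petal. Then `A` goes to
the core: pair hyperedges realise the edges inside `A`, petal hyperedges those leaving `A`. This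
needs `A.card ≤ t`, and distinct kernels representing the neighbours in `A` of any outside vertex.

The seed is free unless the greatest two-core `K` of `F` is `PetalDecomposable`. Let a be the least
size of such an `A` and c that of a vertex cover of `K`; then a < c. If a ≤ 2 or c > k, parameters
with `q ≤ 2` or `s = 1` turn a decomposition into a cover smaller than c. Otherwise 3 ≤ a < c ≤ k ≤
5, and with `t = q = a` a decomposition would force 2a ≤ c (`PetalDecomposable.two_mul_le_card`),
which is absurd. That argument fails for triangle components of `K`, but these give c ≥ a + 2, hence
k = 5 and a = 3, where two special kernels suffice. -/

theorem containsBerge_iff {F : SimpleGraph W} {H : UniformHypergraph k V} :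
    H.ContainsBerge F ↔ ∃ (f : W ↪ V) (g : Sym2 W → Finset V), Set.InjOn g F.edgeSet ∧
      ∀ e ∈ F.edgeSet, g e ∈ H.edges ∧ ∀ w ∈ e, f w ∈ g e := by
  classical
  constructor
  · rintro ⟨H', hsub, f, φ, hφ⟩
    refine ⟨f, fun e => if h : e ∈ F.edgeSet then (φ ⟨e, h⟩ : Finset V) else ∅, ?_, ?_⟩
    · intro a ha b hb hab
      simp only [ha, hb, dite_true] at hab
      simpa using φ.injective (Subtype.ext hab)
    · intro e he
      simp only [he, dite_true]
      exact ⟨hsub (φ ⟨e, he⟩).2, fun w hw => hφ ⟨e, he⟩ w hw⟩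
  · rintro ⟨f, g, hinj, hg⟩
    let H' : UniformHypergraph k V :=
      { edges := H.edges.filter (fun x => ∃ e ∈ F.edgeSet, g e = x)
        uniform := fun e he => H.uniform e (Finset.mem_filter.mp he).1 }
    refine ⟨H', Finset.filter_subset _ _, f, Equiv.ofBijective
      (fun e => ⟨g e, Finset.mem_filter.mpr ⟨(hg e e.2).1, e, e.2, rfl⟩⟩) ⟨?_, ?_⟩, ?_⟩
    · intro a b hab
      exact Subtype.ext (hinj a.2 b.2 (congrArg Subtype.val hab))
    · rintro ⟨x, hx⟩
      obtain ⟨e, he, rfl⟩ := (Finset.mem_filter.mp hx).2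
      exact ⟨⟨e, he⟩, rfl⟩
    · intro e w hw
      exact (hg e e.2).2 w hw

theorem not_containsBerge_of_edges_eq_empty {F : SimpleGraph W} (hF : F ≠ ⊥)
    {H : UniformHypergraph k V} (hH : H.edges = ∅) : ¬ H.ContainsBerge F := by
  rw [containsBerge_iff]
  rintro ⟨f, g, -, hg⟩
  obtain ⟨e, he⟩ := SimpleGraph.edgeSet_nonempty.mpr hF
  have := (hg e he).1
  simp [hH] at this

/-- A maximal Berge-`F`-free extension is saturated, and one exists by finiteness. -/
theorem exists_isBergeSaturated_ge [Finite V] [DecidableEq V] {F : SimpleGraph W}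
    (H₀ : UniformHypergraph k V) (h₀ : ¬ H₀.ContainsBerge F) :
    ∃ H : UniformHypergraph k V, H₀.IsSubhypergraph H ∧ H.IsBergeSaturated F := by
  let s : Set (Finset (Finset V)) :=
    {E | ∃ H : UniformHypergraph k V, H.edges = E ∧ ¬ H.ContainsBerge F}
  obtain ⟨E, hE, hmax⟩ := s.toFinite.exists_le_maximal (a := H₀.edges) ⟨H₀, rfl, h₀⟩
  obtain ⟨H, rfl, hH⟩ := hmax.prop
  refine ⟨H, hE, hH, fun e he hne => ?_⟩
  by_contra hcon
  have := hmax.le_of_ge (y := (H.addEdge e he).edges) ⟨_, rfl, hcon⟩ (Finset.subset_insert _ _)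
  exact hne (this (Finset.mem_insert_self _ _))

end UniformHypergraph

/-! ### Two-cores, and embedding forests in dense hypergraphs -/

/-- Every vertex of `Y` has at least two neighbours in `Y`. -/
def IsTwoCore {W : Type*} (F : SimpleGraph W) (Y : Finset W) : Prop :=
  ∀ y ∈ Y, ∃ a ∈ Y, ∃ b ∈ Y, a ≠ b ∧ F.Adj y a ∧ F.Adj y b

/-- `A` meets every nonempty set inducing minimum degree at least two; equivalently, deleting `A`
leaves a forest. -/
def HitsTwoCores {W : Type*} (F : SimpleGraph W) (A : Finset W) : Prop :=
  ∀ Y, IsTwoCore F Y → Y.Nonempty → ∃ y ∈ Y, y ∈ A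

section Embedding

variable {k : ℕ} {V W : Type*} [Fintype V]

/-- Greedy Berge-embedding of a forest, each vertex into its own label class. -/
theorem exists_forest_embedding [DecidableEq V] {F : SimpleGraph W} {H : UniformHypergraph k V}
    {X U : Finset V} {l : V → ℕ} {s M : ℕ}
    (hl : ∀ c, ((Finset.univ \ X).filter (fun v => l v = c)).card ≤ s)
    (hUX : ∀ u ∈ U, u ∉ X) (hU : U.Nonempty)
    (hdeg : ∀ u ∈ U, ∀ Z : Finset V, Z.card ≤ M →
      ∃ e ∈ H.edges, u ∈ e ∧ ¬ e ⊆ Z ∧ ∀ x ∈ e, x ∉ X → x ∈ U)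
    (T : Finset W) (hM : X.card + T.card * (k * s) ≤ M)
    (hT : ∀ Y ⊆ T, Y.Nonempty → ¬ IsTwoCore F Y) :
    ∃ (f : W → V) (g : Sym2 W → Finset V) (Z : Finset V), X ⊆ Z ∧
      Z.card ≤ X.card + T.card * (k * s) ∧
      (∀ x ∈ Z, x ∉ X → ∀ y, y ∉ X → l y = l x → y ∈ Z) ∧
      (∀ w ∈ T, f w ∈ U ∧ f w ∈ Z) ∧
      (∀ v ∈ T, ∀ w ∈ T, l (f v) = l (f w) → v = w) ∧
      (∀ e ∈ F.edgeSet, (∀ w ∈ e, w ∈ T) → g e ∈ H.edges ∧ g e ⊆ Z ∧ ∀ w ∈ e, f w ∈ g e) ∧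
      (∀ e ∈ F.edgeSet, (∀ w ∈ e, w ∈ T) → ∀ e' ∈ F.edgeSet, (∀ w ∈ e', w ∈ T) →
        g e = g e' → e = e') := by
  classical
  obtain ⟨u₀, hu₀⟩ := hU
  induction hn : T.card generalizing T with
  | zero =>
    obtain rfl := Finset.card_eq_zero.mp hn
    have aux : ∀ e : Sym2 W, ¬ ∀ w ∈ e, w ∈ (∅ : Finset W) := by
      intro e he
      induction e with
      | _ a b => exact absurd (he a (by simp)) (by simp)
    exact ⟨fun _ => u₀, fun _ => ∅, X, subset_rfl, by simp, fun x hx hx' => absurd hx hx', by simp,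
      by simp, fun e _ he => absurd he (aux e), fun e _ he => absurd he (aux e)⟩
  | succ n ih =>
    have hne : T.Nonempty := Finset.card_pos.mp (by omega)
    -- A leaf or isolated vertex `y` of the forest; for an isolated one, `x = y` is a dummy.
    obtain ⟨y, hyT, x, hx⟩ : ∃ y ∈ T, ∃ x, ∀ z ∈ T, F.Adj y z → z = x := by
      have h := hT T subset_rfl hne
      simp only [IsTwoCore, not_forall] at h
      obtain ⟨y, hy, h⟩ := h
      refine ⟨y, hy, ?_⟩
      by_cases h' : ∃ x ∈ T, F.Adj y x
      · obtain ⟨x, hxT, hxy⟩ := h'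
        refine ⟨x, fun z hz hyz => ?_⟩
        by_contra hzx
        exact h ⟨z, hz, x, hxT, hzx, hyz, hxy⟩
      · exact ⟨y, fun z hz hyz => absurd ⟨z, hz, hyz⟩ h'⟩
    have hcard : (T.erase y).card = n := by rw [Finset.card_erase_of_mem hyT]; omega
    have hnk : (n + 1) * (k * s) = n * (k * s) + k * s := by ring
    rw [hn, hnk] at hM
    obtain ⟨f, g, Z, hXZ, hZc, hZcl, hf, hfl, hg, hginj⟩ := ih (T.erase y) (by rw [hcard]; omega)
      (fun Y hY => hT Y (hY.trans (Finset.erase_subset _ _))) hcard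
    -- The new hyperedge must contain the image of the neighbour of `y`; without a neighbour any
    -- vertex of `U` will do.
    let u := if x ∈ T.erase y then f x else u₀
    have huU : u ∈ U := by
      simp only [u]; split_ifs with h
      · exact (hf x h).1
      · exact hu₀
    -- All hyperedges used so far lie in `Z`, so `e` is new. As `Z` is a union of classes outside
    -- `X`, `w` lies in an unused class.
    obtain ⟨e, heH, hue, heZ, heU⟩ := hdeg u huU Z (by omega)
    obtain ⟨w, hwe, hwZ⟩ := Finset.not_subset.mp heZ
    have hwX : w ∉ X := fun h => hwZ (hXZ h)
    have hwU : w ∈ U := heU w hwe hwX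
    let pet : V → Finset V := fun v => (Finset.univ \ X).filter (fun z => l z = l v)
    let Z' := Z ∪ (e \ X).biUnion pet
    have heZ' : e ⊆ Z' := by
      intro z hz
      by_cases hzX : z ∈ X
      · exact Finset.mem_union_left _ (hXZ hzX)
      · exact Finset.mem_union_right _ (Finset.mem_biUnion.mpr
          ⟨z, by simp [hz, hzX], by simp [pet, hzX]⟩)
    have hTe : ∀ z ∈ T, z ≠ y → z ∈ T.erase y := fun z hz hzy => Finset.mem_erase.mpr ⟨hzy, hz⟩
    have hedge : ∀ e' ∈ F.edgeSet, (∀ z ∈ e', z ∈ T) →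
        (e' = s(y, x) ∧ x ∈ T.erase y) ∨ ((∀ z ∈ e', z ∈ T.erase y) ∧ e' ≠ s(y, x)) := by
      intro e' he' heT
      by_cases hye : y ∈ e'
      · left
        obtain ⟨z, rfl⟩ := hye
        have hyz : F.Adj y z := he'
        have hzT := heT z (by simp)
        obtain rfl := hx z hzT hyz
        exact ⟨rfl, hTe _ hzT hyz.ne'⟩
      · right
        refine ⟨fun z hz => hTe z (heT z hz) (fun h => hye (h ▸ hz)), ?_⟩
        rintro rfl
        simp at hye
    have hlw : ∀ v ∈ T.erase y, l (f v) ≠ l w := by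
      intro v hv h
      exact hwZ (hZcl (f v) (hf v hv).2 (hUX _ (hf v hv).1) w hwX h.symm)
    refine ⟨Function.update f y w, Function.update g s(y, x) e, Z', ?_, ?_, ?_, ?_, ?_, ?_, ?_⟩
    · exact hXZ.trans Finset.subset_union_left
    · have h1 : ((e \ X).biUnion pet).card ≤ k * s := by
        refine (Finset.card_biUnion_le_card_mul _ _ s (fun v _ => hl (l v))).trans ?_
        exact Nat.mul_le_mul_right _ ((Finset.card_le_card Finset.sdiff_subset).trans
          (H.uniform e heH).le)
      rw [hnk]
      exact (Finset.card_union_le _ _).trans (by omega)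
    · intro a ha haX b hbX hab
      rcases Finset.mem_union.mp ha with ha | ha
      · exact Finset.mem_union_left _ (hZcl a ha haX b hbX hab)
      · obtain ⟨c, hc, hac⟩ := Finset.mem_biUnion.mp ha
        refine Finset.mem_union_right _ (Finset.mem_biUnion.mpr ⟨c, hc, ?_⟩)
        simp only [pet, Finset.mem_filter] at hac ⊢
        exact ⟨by simpa using hbX, hab.trans hac.2⟩
    · intro v hv
      by_cases hvy : v = y
      · subst hvy; simp only [Function.update_self]; exact ⟨hwU, heZ' hwe⟩
      · rw [Function.update_of_ne hvy]
        exact ⟨(hf v (hTe v hv hvy)).1, Finset.mem_union_left _ (hf v (hTe v hv hvy)).2⟩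
    · intro a ha b hb hab
      by_cases hay : a = y <;> by_cases hby : b = y
      · rw [hay, hby]
      · subst hay
        rw [Function.update_self, Function.update_of_ne hby] at hab
        exact absurd hab.symm (hlw b (hTe b hb hby))
      · subst hby
        rw [Function.update_self, Function.update_of_ne hay] at hab
        exact absurd hab (hlw a (hTe a ha hay))
      · rw [Function.update_of_ne hay, Function.update_of_ne hby] at hab
        exact hfl a (hTe a ha hay) b (hTe b hb hby) hab
    · intro e' he' heT
      rcases hedge e' he' heT with ⟨rfl, hxT⟩ | ⟨h, hne⟩
      · rw [Function.update_self]
        refine ⟨heH, heZ', ?_⟩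
        intro z hz
        rcases Sym2.mem_iff.mp hz with rfl | rfl
        · simpa using hwe
        · rw [Function.update_of_ne (Finset.ne_of_mem_erase hxT)]
          simpa [u, hxT] using hue
      · rw [Function.update_of_ne hne]
        obtain ⟨h1, h2, h3⟩ := hg e' he' h
        refine ⟨h1, h2.trans Finset.subset_union_left, fun z hz => ?_⟩
        rw [Function.update_of_ne (Finset.ne_of_mem_erase (h z hz))]
        exact h3 z hz
    · intro a ha haT b hb hbT hab
      rcases hedge a ha haT with ⟨rfl, hxT⟩ | ⟨h, hne⟩ <;>
        rcases hedge b hb hbT with ⟨rfl, hxT'⟩ | ⟨h', hne'⟩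
      · rfl
      · rw [Function.update_self, Function.update_of_ne hne'] at hab
        exact absurd (hab ▸ (hg b hb h').2.1) heZ
      · rw [Function.update_self, Function.update_of_ne hne] at hab
        exact absurd (hab ▸ (hg a ha h).2.1) heZ
      · rw [Function.update_of_ne hne, Function.update_of_ne hne'] at hab
        exact hginj a ha h b hb h' hab

/-- If all edges not inside the forest `F - A` can be realised by the hyperedges of `H` locally and
the hyperedges of `H` are dense on `U`, then `H` contains a Berge-`F`. -/
theorem containsBerge_of_dense [Fintype W] [DecidableEq V] {F : SimpleGraph W}
    {H : UniformHypergraph k V}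
    {X U : Finset V} {l : V → ℕ} {s : ℕ} {A : Finset W} (hA : HitsTwoCores F A)
    (f₀ : W → V) (hf₀X : ∀ a ∈ A, f₀ a ∈ X) (hf₀ : Set.InjOn f₀ A) (g₀ : Sym2 W → Finset V)
    (hg₀ : ∀ e ∈ F.edgeSet, (∀ w ∈ e, w ∈ A) →
      g₀ e ∈ H.edges ∧ g₀ e ⊆ X ∧ ∀ w ∈ e, f₀ w ∈ g₀ e)
    (hg₀inj : ∀ e ∈ F.edgeSet, (∀ w ∈ e, w ∈ A) → ∀ e' ∈ F.edgeSet, (∀ w ∈ e', w ∈ A) →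
      g₀ e = g₀ e' → e = e')
    (hmix : ∀ v, v ∉ A → ∀ b, b ∉ X → ∃ h : W → Finset V,
      (∀ a ∈ A, F.Adj v a → h a ∈ H.edges ∧ f₀ a ∈ h a ∧ b ∈ h a ∧
        ∀ x ∈ h a, x ∉ X → l x = l b) ∧
      ∀ a ∈ A, F.Adj v a → ∀ a' ∈ A, F.Adj v a' → h a = h a' → a = a')
    (hl : ∀ c, ((Finset.univ \ X).filter (fun v => l v = c)).card ≤ s)
    (hUX : ∀ u ∈ U, u ∉ X) (hU : U.Nonempty)
    (hdeg : ∀ u ∈ U, ∀ Z : Finset V, Z.card ≤ X.card + Fintype.card W * (k * s) →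
      ∃ e ∈ H.edges, u ∈ e ∧ ¬ e ⊆ Z ∧ ∀ x ∈ e, x ∉ X → x ∈ U) :
    H.ContainsBerge F := by
  classical
  obtain ⟨f₁, g₁, Z, -, -, -, hf₁, hf₁l, hg₁, hg₁inj⟩ := exists_forest_embedding (F := F) hl hUX hU
    hdeg (Finset.univ \ A)
    (Nat.add_le_add_left (Nat.mul_le_mul_right _ (Finset.card_le_univ _)) _)
    (fun Y hY hYne hcore => by
      obtain ⟨y, hy, hyA⟩ := hA Y hcore hYne
      exact (Finset.mem_sdiff.mp (hY hy)).2 hyA)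
  have hcompl : ∀ v, v ∈ Finset.univ \ A ↔ v ∉ A := by simp
  simp only [hcompl] at hf₁ hf₁l hg₁ hg₁inj
  have hf₁X : ∀ v, v ∉ A → f₁ v ∉ X := fun v hv => hUX _ (hf₁ v hv).1
  have hmix' : ∀ v, v ∉ A → ∃ h : W → Finset V,
      (∀ a ∈ A, F.Adj v a → h a ∈ H.edges ∧ f₀ a ∈ h a ∧ f₁ v ∈ h a ∧
        ∀ x ∈ h a, x ∉ X → l x = l (f₁ v)) ∧
      ∀ a ∈ A, F.Adj v a → ∀ a' ∈ A, F.Adj v a' → h a = h a' → a = a' :=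
    fun v hv => hmix v hv (f₁ v) (hf₁X v hv)
  choose! h hh hhinj using hmix'
  let f : W → V := fun w => if w ∈ A then f₀ w else f₁ w
  have hfA : ∀ w ∈ A, f w = f₀ w := fun w hw => by simp [f, hw]
  have hfT : ∀ w, w ∉ A → f w = f₁ w := fun w hw => by simp [f, hw]
  have hfinj : Function.Injective f := by
    intro a b hab
    by_cases ha : a ∈ A <;> by_cases hb : b ∈ A
    · rw [hfA a ha, hfA b hb] at hab; exact hf₀ ha hb hab
    · rw [hfA a ha, hfT b hb] at hab; exact absurd (hab ▸ hf₀X a ha) (hf₁X b hb)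
    · rw [hfT a ha, hfA b hb] at hab; exact absurd (hab ▸ hf₀X b hb) (hf₁X a ha)
    · rw [hfT a ha, hfT b hb] at hab; exact hf₁l a ha b hb (by rw [hab])
  have key : ∀ e ∈ F.edgeSet, ∃ E, (E ∈ H.edges ∧ ∀ w ∈ e, f w ∈ E) ∧
      (((∀ w ∈ e, w ∈ A) ∧ E = g₀ e) ∨ ((∀ w ∈ e, w ∉ A) ∧ E = g₁ e) ∨
        ∃ a ∈ A, ∃ v, v ∉ A ∧ F.Adj v a ∧ e = s(v, a) ∧ E = h v a) := by
    intro e he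
    induction e with
    | _ a b =>
    have hab : F.Adj a b := he
    have mixed : ∀ a ∈ A, ∀ v, v ∉ A → F.Adj v a → h v a ∈ H.edges ∧
        ∀ w ∈ s(v, a), f w ∈ h v a := by
      intro a ha v hv hva
      obtain ⟨h1, h2, h3, -⟩ := hh v hv a ha hva
      refine ⟨h1, fun w hw => ?_⟩
      rcases Sym2.mem_iff.mp hw with rfl | rfl
      · rwa [hfT _ hv]
      · rwa [hfA _ ha]
    by_cases ha : a ∈ A <;> by_cases hb : b ∈ A
    · have hall : ∀ w ∈ s(a, b), w ∈ A := by
        intro w hw; rcases Sym2.mem_iff.mp hw with rfl | rfl <;> assumption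
      obtain ⟨h1, -, h3⟩ := hg₀ _ he hall
      exact ⟨_, ⟨h1, fun w hw => by rw [hfA w (hall w hw)]; exact h3 w hw⟩, Or.inl ⟨hall, rfl⟩⟩
    · exact ⟨_, Sym2.eq_swap ▸ mixed a ha b hb hab.symm,
        Or.inr (Or.inr ⟨a, ha, b, hb, hab.symm, Sym2.eq_swap, rfl⟩)⟩
    · exact ⟨_, mixed b hb a ha hab, Or.inr (Or.inr ⟨b, hb, a, ha, hab, rfl, rfl⟩)⟩
    · have hall : ∀ w ∈ s(a, b), w ∉ A := by
        intro w hw; rcases Sym2.mem_iff.mp hw with rfl | rfl <;> assumption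
      obtain ⟨h1, -, h3⟩ := hg₁ _ he hall
      exact ⟨_, ⟨h1, fun w hw => by rw [hfT w (hall w hw)]; exact h3 w hw⟩,
        Or.inr (Or.inl ⟨hall, rfl⟩)⟩
  choose! g hg hgcase using key
  rw [UniformHypergraph.containsBerge_iff]
  refine ⟨⟨f, hfinj⟩, g, ?_, hg⟩
  -- The three kinds of hyperedge cannot coincide: `g₀` stays inside `X`, `h` meets exactly one
  -- class outside `X`, and `g₁` meets at least two.
  have c01 : ∀ e ∈ F.edgeSet, (∀ w ∈ e, w ∈ A) → ∀ E, (∃ v ∈ E, v ∉ X) → g₀ e ≠ E := by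
    rintro e he heA E ⟨v, hvE, hvX⟩ rfl
    exact hvX ((hg₀ e he heA).2.1 hvE)
  have c1 : ∀ e ∈ F.edgeSet, (∀ w ∈ e, w ∉ A) → ∃ v ∈ g₁ e, v ∉ X := by
    intro e he heA
    induction e with
    | _ a b => exact ⟨f₁ a, (hg₁ _ he heA).2.2 a (by simp), hf₁X a (heA a (by simp))⟩
  have c2 : ∀ a ∈ A, ∀ v, v ∉ A → F.Adj v a → ∃ x ∈ h v a, x ∉ X := by
    intro a ha v hv hva
    exact ⟨f₁ v, (hh v hv a ha hva).2.2.1, hf₁X v hv⟩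
  have c12 : ∀ e ∈ F.edgeSet, (∀ w ∈ e, w ∉ A) → ∀ a ∈ A, ∀ v, v ∉ A → F.Adj v a →
      g₁ e ≠ h v a := by
    intro e he heA a ha v hv hva heq
    induction e with
    | _ x y =>
    have hx := heA x (by simp)
    have hy := heA y (by simp)
    have h3 := (hg₁ _ he heA).2.2
    rw [heq] at h3
    have hlab := (hh v hv a ha hva).2.2.2
    have hxy : F.Adj x y := he
    refine hxy.ne (hf₁l x hx y hy ?_)
    rw [hlab _ (h3 x (by simp)) (hf₁X x hx), hlab _ (h3 y (by simp)) (hf₁X y hy)]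
  intro e he e' he' heq
  rcases hgcase e he with ⟨heA, hE⟩ | ⟨heA, hE⟩ | ⟨a, ha, v, hv, hva, rfl, hE⟩ <;>
    rcases hgcase e' he' with ⟨heA', hE'⟩ | ⟨heA', hE'⟩ | ⟨a', ha', v', hv', hva', rfl, hE'⟩ <;>
    rw [hE, hE'] at heq
  · exact hg₀inj e he heA e' he' heA' heq
  · exact absurd heq (c01 e he heA _ (c1 e' he' heA'))
  · exact absurd heq (c01 e he heA _ (c2 a' ha' v' hv' hva'))
  · exact absurd heq.symm (c01 e' he' heA' _ (c1 e he heA))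
  · exact hg₁inj e he heA e' he' heA' heq
  · exact absurd heq (c12 e he heA a' ha' v' hv' hva')
  · exact absurd heq.symm (c01 e' he' heA' _ (c2 a ha v hv hva))
  · exact absurd heq.symm (c12 e' he' heA' a ha v hv hva)
  · have h1 := (hh v' hv' a' ha' hva').2.2.1
    rw [← heq] at h1
    have hvv := hf₁l v' hv' v hv ((hh v hv a ha hva).2.2.2 _ h1 (hf₁X v' hv'))
    subst hvv
    rw [hhinj v' hv a ha hva a' ha' hva' heq]

/-- A hypergraph with many hyperedges is dense on some nonempty set `U` outside `X`. -/
theorem exists_dense_subset [DecidableEq V] (H : UniformHypergraph k V) (X : Finset V) (M : ℕ)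
    (hH : (2 ^ M + 1) * Fintype.card V + 2 ^ X.card < H.edges.card) :
    ∃ U : Finset V, U.Nonempty ∧ (∀ u ∈ U, u ∉ X) ∧
      ∀ u ∈ U, ∀ Z : Finset V, Z.card ≤ M →
        ∃ e ∈ H.edges, u ∈ e ∧ ¬ e ⊆ Z ∧ ∀ x ∈ e, x ∉ X → x ∈ U := by
  let E : Finset V → Finset (Finset V) := fun U => H.edges.filter (fun e => e \ X ⊆ U)
  -- A smallest `U` in `S` works: if the hyperedges at `u` that stay in `U ∪ X` all lay in some
  -- small `Z`, deleting `u` would lose at most `2 ^ M` of them, while the threshold drops by `2 ^ M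
  -- + 1`.
  let S : Finset (Finset V) := (Finset.univ \ X).powerset.filter
    (fun U => (2 ^ M + 1) * U.card + 2 ^ X.card < (E U).card)
  have hS : S.Nonempty := by
    refine ⟨Finset.univ \ X, Finset.mem_filter.mpr ⟨Finset.mem_powerset_self _, ?_⟩⟩
    have hE : E (Finset.univ \ X) = H.edges :=
      Finset.filter_true_of_mem (fun e _ => Finset.sdiff_subset_sdiff (Finset.subset_univ e) le_rfl)
    rw [hE]
    have : (2 ^ M + 1) * (Finset.univ \ X).card ≤ (2 ^ M + 1) * Fintype.card V :=
      Nat.mul_le_mul_left _ (Finset.card_le_univ _)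
    omega
  obtain ⟨U, hUS, hmin⟩ := S.exists_min_image Finset.card hS
  obtain ⟨hUX, hUc⟩ := Finset.mem_filter.mp hUS
  have hUX' : ∀ u ∈ U, u ∉ X := fun u hu =>
    (Finset.mem_sdiff.mp (Finset.mem_powerset.mp hUX hu)).2
  refine ⟨U, ?_, hUX', ?_⟩
  · rw [Finset.nonempty_iff_ne_empty]
    rintro rfl
    have : (E ∅).card ≤ 2 ^ X.card := by
      rw [← Finset.card_powerset]
      refine Finset.card_le_card fun e he => Finset.mem_powerset.mpr ?_
      have := (Finset.mem_filter.mp he).2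
      rwa [Finset.subset_empty, Finset.sdiff_eq_empty_iff_subset] at this
    simp only [Finset.card_empty] at hUc
    omega
  · intro u hu Z hZ
    by_contra hcon
    push Not at hcon
    have hsub : E U ⊆ E (U.erase u) ∪ Z.powerset := by
      intro e he
      obtain ⟨heH, heU⟩ := Finset.mem_filter.mp he
      by_cases hue : u ∈ e
      · refine Finset.mem_union_right _ (Finset.mem_powerset.mpr ?_)
        by_contra heZ
        obtain ⟨x, hx, hxX, hxU⟩ := hcon e heH hue heZ
        exact hxU (heU (Finset.mem_sdiff.mpr ⟨hx, hxX⟩))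
      · refine Finset.mem_union_left _ (Finset.mem_filter.mpr ⟨heH, fun x hx => ?_⟩)
        refine Finset.mem_erase.mpr ⟨?_, heU hx⟩
        rintro rfl
        exact hue (Finset.mem_sdiff.mp hx).1
    have h1 := (Finset.card_le_card hsub).trans (Finset.card_union_le _ _)
    rw [Finset.card_powerset] at h1
    have h2 : 2 ^ Z.card ≤ 2 ^ M := Nat.pow_le_pow_right (by norm_num) hZ
    have h3 := Finset.card_erase_add_one hu
    have h4 : U.erase u ∈ S := by
      refine Finset.mem_filter.mpr ⟨Finset.mem_powerset.mpr
        ((Finset.erase_subset _ _).trans (Finset.mem_powerset.mp hUX)), ?_⟩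
      rw [← h3] at hUc
      have : (2 ^ M + 1) * ((U.erase u).card + 1) =
        (2 ^ M + 1) * (U.erase u).card + (2 ^ M + 1) := by ring
      omega
    have := hmin _ h4
    omega

end Embedding

/-! ### The petal hypergraph: Berge copies in it and in its extensions -/

section Petals

variable {k t q s N : ℕ} {V W : Type*}

/-- The hyperedge consisting of the `i`-th kernel and the `j`-th petal. -/
def petalEdge (S : Fin q → Finset (Fin t))
    (ι : Fin t ⊕ (Sym2 (Fin t) × Fin (k - 2)) ⊕ (Fin N × Fin s) ↪ V) (i : Fin q) (j : Fin N) :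
    Finset V :=
  ((S i).disjSum ((∅ : Finset (Sym2 (Fin t) × Fin (k - 2))).disjSum
    (({j} : Finset (Fin N)) ×ˢ Finset.univ))).map ι

/-- A hyperedge joining the two core vertices of the pair `z` by means of private vertices. -/
def pairEdge (ι : Fin t ⊕ (Sym2 (Fin t) × Fin (k - 2)) ⊕ (Fin N × Fin s) ↪ V)
    (z : Sym2 (Fin t)) : Finset V :=
  (z.toFinset.disjSum ((({z} : Finset (Sym2 (Fin t))) ×ˢ Finset.univ).disjSum
    (∅ : Finset (Fin N × Fin s)))).map ι

/-- The hypergraph with core `Fin t`, kernels `S i`, and petals of size `s`. -/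
def petalHypergraph [DecidableEq V] (hk : 2 ≤ k) (S : Fin q → Finset (Fin t))
    (hS : ∀ i, (S i).card + s = k)
    (ι : Fin t ⊕ (Sym2 (Fin t) × Fin (k - 2)) ⊕ (Fin N × Fin s) ↪ V) :
    UniformHypergraph k V where
  edges := Finset.univ.image (fun p : Fin q × Fin N => petalEdge S ι p.1 p.2) ∪
    (Finset.univ.filter (fun z : Sym2 (Fin t) => ¬ z.IsDiag)).image (pairEdge ι)
  uniform := by
    intro e he
    rcases Finset.mem_union.mp he with he | he
    · obtain ⟨⟨i, j⟩, -, rfl⟩ := Finset.mem_image.mp he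
      simp [petalEdge, Finset.card_disjSum, hS]
    · obtain ⟨z, hz, rfl⟩ := Finset.mem_image.mp he
      have := Sym2.card_toFinset_of_not_isDiag z (by simpa using hz)
      simp [pairEdge, Finset.card_disjSum, this]
      omega

variable (S : Fin q → Finset (Fin t))
  (ι : Fin t ⊕ (Sym2 (Fin t) × Fin (k - 2)) ⊕ (Fin N × Fin s) ↪ V)

@[simp] theorem core_mem_petalEdge {i : Fin q} {j : Fin N} {a : Fin t} :
    ι (Sum.inl a) ∈ petalEdge S ι i j ↔ a ∈ S i := by
  simp [petalEdge]

@[simp] theorem petal_mem_petalEdge {i : Fin q} {j : Fin N} {p : Fin N × Fin s} :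
    ι (Sum.inr (Sum.inr p)) ∈ petalEdge S ι i j ↔ p.1 = j := by
  obtain ⟨a, b⟩ := p
  simp [petalEdge, eq_comm]

@[simp] theorem junk_notMem_petalEdge {i : Fin q} {j : Fin N} {p : Sym2 (Fin t) × Fin (k - 2)} :
    ι (Sum.inr (Sum.inl p)) ∉ petalEdge S ι i j := by
  simp [petalEdge]

@[simp] theorem core_mem_pairEdge {z : Sym2 (Fin t)} {a : Fin t} :
    ι (Sum.inl a) ∈ pairEdge ι z ↔ a ∈ z := by
  simp [pairEdge]

@[simp] theorem petal_notMem_pairEdge {z : Sym2 (Fin t)} {p : Fin N × Fin s} :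
    ι (Sum.inr (Sum.inr p)) ∉ pairEdge ι z := by
  simp [pairEdge]

@[simp] theorem junk_mem_pairEdge {z : Sym2 (Fin t)} {p : Sym2 (Fin t) × Fin (k - 2)} :
    ι (Sum.inr (Sum.inl p)) ∈ pairEdge ι z ↔ p.1 = z := by
  obtain ⟨a, b⟩ := p
  simp [pairEdge, eq_comm]

theorem exists_of_mem_petalEdge {i : Fin q} {j : Fin N} {v : V} (h : v ∈ petalEdge S ι i j) :
    ∃ x, ι x = v := by
  obtain ⟨x, -, rfl⟩ := Finset.mem_map.mp h
  exact ⟨x, rfl⟩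

theorem exists_of_mem_pairEdge {z : Sym2 (Fin t)} {v : V} (h : v ∈ pairEdge ι z) :
    ∃ x, ι x = v := by
  obtain ⟨x, -, rfl⟩ := Finset.mem_map.mp h
  exact ⟨x, rfl⟩

open Classical in
/-- The index of the petal containing a vertex (and `0` outside the petals). -/
noncomputable def petalLabel (v : V) : ℕ :=
  if h : ∃ p : Fin N × Fin s, ι (Sum.inr (Sum.inr p)) = v then h.choose.1 else 0

@[simp] theorem petalLabel_apply (p : Fin N × Fin s) :
    petalLabel ι (ι (Sum.inr (Sum.inr p))) = p.1 := by
  have h : ∃ p' : Fin N × Fin s, ι (Sum.inr (Sum.inr p')) = ι (Sum.inr (Sum.inr p)) := ⟨p, rfl⟩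
  unfold petalLabel
  rw [dif_pos h]
  simp

/-- A hyperedge containing a petal vertex is one of the petal hyperedges of this petal. -/
theorem eq_petalEdge_of_mem [DecidableEq V] {hk : 2 ≤ k} {hS : ∀ i, (S i).card + s = k}
    {e : Finset V} (he : e ∈ (petalHypergraph hk S hS ι).edges) {p : Fin N × Fin s}
    (hp : ι (Sum.inr (Sum.inr p)) ∈ e) : ∃ i, e = petalEdge S ι i p.1 := by
  rcases Finset.mem_union.mp he with he | he
  · obtain ⟨⟨i, j⟩, -, rfl⟩ := Finset.mem_image.mp he
    simp only [petal_mem_petalEdge] at hp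
    exact ⟨i, by simp [hp]⟩
  · obtain ⟨z, -, rfl⟩ := Finset.mem_image.mp he
    simp at hp

theorem eq_pairEdge_of_mem [DecidableEq V] {hk : 2 ≤ k} {hS : ∀ i, (S i).card + s = k}
    {e : Finset V} (he : e ∈ (petalHypergraph hk S hS ι).edges) {p : Sym2 (Fin t) × Fin (k - 2)}
    (hp : ι (Sum.inr (Sum.inl p)) ∈ e) : e = pairEdge ι p.1 := by
  rcases Finset.mem_union.mp he with he | he
  · obtain ⟨⟨i, j⟩, -, rfl⟩ := Finset.mem_image.mp he
    simp at hp
  · obtain ⟨z, -, rfl⟩ := Finset.mem_image.mp he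
    simp only [junk_mem_pairEdge] at hp
    simp [hp]

/-- `K` splits into at most `t` vertices `A` and classes of size at most `s`, each touching at most
`q` edges, with no edges between different classes. -/
def PetalDecomposable (F : SimpleGraph W) (K : Finset W) (t s q : ℕ) : Prop :=
  ∃ (A : Finset W) (c : W → ℕ), A ⊆ K ∧ A.card ≤ t ∧
    (∀ u ∈ K, ∀ v ∈ K, u ∉ A → v ∉ A → F.Adj u v → c u = c v) ∧
    (∀ n, ∀ Y : Finset W, (∀ y ∈ Y, y ∈ K ∧ y ∉ A ∧ c y = n) → Y.card ≤ s) ∧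
    (∀ n, ∀ E : Finset (Sym2 W), (∀ e ∈ E, e ∈ F.edgeSet ∧ (∀ w ∈ e, w ∈ K) ∧
      ∃ w ∈ e, w ∉ A ∧ c w = n) → E.card ≤ q)

/-- The vertices of `K` embedded in the core form the set `A`, and the petals give the classes. A
petal meets only `q` hyperedges, and distinct edges of `F` use distinct hyperedges. -/
theorem petalDecomposable_of_containsBerge [DecidableEq V] {hk : 2 ≤ k}
    {hS : ∀ i, (S i).card + s = k} {F : SimpleGraph W} {K : Finset W} (hK : IsTwoCore F K)
    (h : (petalHypergraph hk S hS ι).ContainsBerge F) : PetalDecomposable F K t s q := by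
  classical
  obtain ⟨f, g, hginj, hg⟩ := UniformHypergraph.containsBerge_iff.mp h
  set H := petalHypergraph hk S hS ι with hH
  have hpet : ∀ w ∈ K, (¬ ∃ a, ι (Sum.inl a) = f w) →
      ∃ p : Fin N × Fin s, ι (Sum.inr (Sum.inr p)) = f w := by
    intro w hw hwA
    obtain ⟨a, -, b, -, hab, ha, hb⟩ := hK w hw
    obtain ⟨hga, hga'⟩ := hg s(w, a) ha
    obtain ⟨hgb, hgb'⟩ := hg s(w, b) hb
    have hx : ∃ x, ι x = f w := by
      rcases Finset.mem_union.mp hga with he | he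
      · obtain ⟨⟨i, j⟩, -, he⟩ := Finset.mem_image.mp he
        exact exists_of_mem_petalEdge S ι (i := i) (j := j) (by rw [he]; exact hga' w (by simp))
      · obtain ⟨z, -, he⟩ := Finset.mem_image.mp he
        exact exists_of_mem_pairEdge ι (z := z) (by rw [he]; exact hga' w (by simp))
    obtain ⟨x | p | p, hx⟩ := hx
    · exact absurd ⟨x, hx⟩ hwA
    -- A private vertex lies in just one hyperedge, but `w` has two edges of `F`, which need
    -- different ones.
    · have h1 := eq_pairEdge_of_mem S ι hga (p := p) (by rw [hx]; exact hga' w (by simp))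
      have h2 := eq_pairEdge_of_mem S ι hgb (p := p) (by rw [hx]; exact hgb' w (by simp))
      have := hginj ha hb (h1.trans h2.symm)
      simp only [Sym2.eq_iff, true_and] at this
      rcases this with h | ⟨h, h'⟩
      · exact absurd h hab
      · exact absurd (h'.trans h) hab
    · exact ⟨p, hx⟩
  have hmemA : ∀ w ∈ K, w ∉ K.filter (fun w => ∃ a, ι (Sum.inl a) = f w) →
      ∃ p : Fin N × Fin s, ι (Sum.inr (Sum.inr p)) = f w := by
    intro w hw hwA
    exact hpet w hw (fun h => hwA (Finset.mem_filter.mpr ⟨hw, h⟩))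
  refine ⟨K.filter (fun w => ∃ a, ι (Sum.inl a) = f w), fun w => petalLabel ι (f w),
    Finset.filter_subset _ _, ?_, ?_, ?_, ?_⟩
  · have : (K.filter (fun w => ∃ a, ι (Sum.inl a) = f w)).map f ⊆
        Finset.univ.image (fun a : Fin t => ι (Sum.inl a)) := by
      intro v hv
      obtain ⟨w, hw, rfl⟩ := Finset.mem_map.mp hv
      obtain ⟨a, ha⟩ := (Finset.mem_filter.mp hw).2
      exact Finset.mem_image.mpr ⟨a, Finset.mem_univ _, ha⟩
    have := (Finset.card_le_card this).trans Finset.card_image_le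
    simpa using this
  · intro u hu v hv huA hvA huv
    obtain ⟨p, hp⟩ := hmemA u hu huA
    obtain ⟨p', hp'⟩ := hmemA v hv hvA
    obtain ⟨he, he'⟩ := hg s(u, v) huv
    obtain ⟨i, hi⟩ := eq_petalEdge_of_mem S ι he (p := p) (by rw [hp]; exact he' u (by simp))
    have hv' := he' v (by simp)
    rw [hi, ← hp', petal_mem_petalEdge] at hv'
    simp only [← hp, ← hp', petalLabel_apply, hv']
  · intro n Y hY
    by_cases hn : n < N
    · have : Y.map f ⊆
          Finset.univ.image (fun i : Fin s => ι (Sum.inr (Sum.inr (⟨n, hn⟩, i)))) := by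
        intro v hv
        obtain ⟨w, hw, rfl⟩ := Finset.mem_map.mp hv
        obtain ⟨hwK, hwA, hwn⟩ := hY w hw
        obtain ⟨⟨a, b⟩, hp⟩ := hmemA w hwK hwA
        simp only [← hp, petalLabel_apply] at hwn
        refine Finset.mem_image.mpr ⟨b, Finset.mem_univ _, ?_⟩
        rw [← hp]
        simp [← hwn]
      have := (Finset.card_le_card this).trans Finset.card_image_le
      simpa using this
    · have : Y = ∅ := by
        refine Finset.eq_empty_of_forall_notMem fun w hw => ?_
        obtain ⟨hwK, hwA, hwn⟩ := hY w hw
        obtain ⟨p, hp⟩ := hmemA w hwK hwA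
        simp only [← hp, petalLabel_apply] at hwn
        exact hn (hwn ▸ p.1.2)
      simp [this]
  · intro n E hE
    by_cases hn : n < N
    · have hsub : E.image g ⊆ Finset.univ.image (fun i : Fin q => petalEdge S ι i ⟨n, hn⟩) := by
        intro x hx
        obtain ⟨e, he, rfl⟩ := Finset.mem_image.mp hx
        obtain ⟨heF, heK, w, hwe, hwA, hwn⟩ := hE e he
        obtain ⟨p, hp⟩ := hmemA w (heK w hwe) hwA
        simp only [← hp, petalLabel_apply] at hwn
        obtain ⟨i, hi⟩ := eq_petalEdge_of_mem S ι (hg e heF).1 (p := p)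
          (by rw [hp]; exact (hg e heF).2 w hwe)
        refine Finset.mem_image.mpr ⟨i, Finset.mem_univ _, ?_⟩
        rw [hi]
        simp [← hwn]
      have h1 := (Finset.card_le_card hsub).trans Finset.card_image_le
      rw [Finset.card_image_of_injOn (fun a ha b hb hab =>
        hginj (hE a ha).1 (hE b hb).1 hab)] at h1
      simpa using h1
    · have : E = ∅ := by
        refine Finset.eq_empty_of_forall_notMem fun e he => ?_
        obtain ⟨heF, heK, w, hwe, hwA, hwn⟩ := hE e he
        obtain ⟨p, hp⟩ := hmemA w (heK w hwe) hwA
        simp only [← hp, petalLabel_apply] at hwn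
        exact hn (hwn ▸ p.1.2)
      simp [this]

/-- Any Berge-`F`-free hypergraph containing `petalHypergraph` has linearly many hyperedges. -/
theorem card_edges_le_of_petalHypergraph_le [Fintype V] [Fintype W] [DecidableEq V] {hk : 2 ≤ k}
    (hk3 : 3 ≤ k) {hS : ∀ i, (S i).card + s = k} (hSinj : Function.Injective S) (ht : 0 < t)
    {d x : ℕ}
    (hrep : ∀ Q : Finset (Fin t), Q.card ≤ d → ∃ σ : Fin t → Fin q, Set.InjOn σ Q ∧
      ∀ a ∈ Q, a ∈ S (σ a))
    {F : SimpleGraph W} {A : Finset W} (hA : HitsTwoCores F A) (hAt : A.card ≤ t)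
    (hAd : ∀ v, v ∉ A → ∀ Q ⊆ A, (∀ a ∈ Q, F.Adj v a) → Q.card ≤ d)
    (hx : Fintype.card V ≤ N * s + x)
    {H : UniformHypergraph k V} (hsub : (petalHypergraph hk S hS ι).IsSubhypergraph H)
    (hH : ¬ H.ContainsBerge F) :
    H.edges.card ≤ (2 ^ (x + Fintype.card W * (k * s)) + 1) * Fintype.card V + 2 ^ x := by
  classical
  by_contra hcon
  let P : Finset V := Finset.univ.image (fun p : Fin N × Fin s => ι (Sum.inr (Sum.inr p)))
  have hPc : P.card = N * s := by
    rw [Finset.card_image_of_injective _ (fun a b hab => by simpa using hab)]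
    simp
  -- Everything outside the petals: core, private and leftover vertices.
  let X : Finset V := Finset.univ \ P
  have hXc : X.card ≤ x := by
    have : X.card = Fintype.card V - P.card := Finset.card_univ_sdiff P
    omega
  have hX : ∀ v, v ∉ X → ∃ p : Fin N × Fin s, ι (Sum.inr (Sum.inr p)) = v := by
    intro v hv
    simpa [X, P] using hv
  have h2 : 2 ^ X.card ≤ 2 ^ x := Nat.pow_le_pow_right (by norm_num) hXc
  obtain ⟨U, hU, hUX, hdeg⟩ := exists_dense_subset H X (x + Fintype.card W * (k * s)) (by omega)
  obtain ⟨β, hβ⟩ : ∃ β : W → Fin t, Set.InjOn β A := by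
    obtain ⟨φ⟩ := Function.Embedding.nonempty_of_card_le
      (α := A) (β := Fin t) (by simpa using hAt)
    refine ⟨fun w => if h : w ∈ A then φ ⟨w, h⟩ else ⟨0, ht⟩, ?_⟩
    intro a ha b hb hab
    have ha' : a ∈ A := ha
    have hb' : b ∈ A := hb
    simpa [ha', hb'] using hab
  have hpairmem : ∀ z : Sym2 (Fin t), ¬ z.IsDiag → pairEdge ι z ∈ H.edges := fun z hz =>
    hsub (Finset.mem_union_right _ (Finset.mem_image_of_mem _ (by simpa using hz)))
  have hpetmem : ∀ i j, petalEdge S ι i j ∈ H.edges := fun i j =>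
    hsub (Finset.mem_union_left _ (Finset.mem_image.mpr ⟨(i, j), Finset.mem_univ _, rfl⟩))
  refine hH (containsBerge_of_dense (l := petalLabel ι) (s := s) (X := X) (U := U) hA
    (fun w => ι (Sum.inl (β w))) ?_ ?_ (fun e => pairEdge ι (e.map β)) ?_ ?_ ?_ ?_ hUX hU
    (fun u hu Z hZ => hdeg u hu Z (hZ.trans (by omega))))
  · intro a _
    simp [X, P]
  · intro a ha b hb hab
    exact hβ ha hb (by simpa using hab)
  · intro e he heA
    induction e with
    | _ a b =>
    refine ⟨hpairmem _ ?_, ?_, ?_⟩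
    · simp only [Sym2.map_mk, Sym2.mk_isDiag_iff]
      exact fun h => SimpleGraph.Adj.ne he (hβ (heA a (by simp)) (heA b (by simp)) h)
    · intro v hv
      by_contra hvX
      obtain ⟨p, rfl⟩ := hX v hvX
      simp at hv
    · intro w hw
      simp only [core_mem_pairEdge, Sym2.mem_map]
      exact ⟨w, hw, rfl⟩
  · intro e he heA e' he' heA' heq
    have hz : e.map β = e'.map β := by
      -- A private vertex, available because `k ≥ 3`, identifies the pair.
      have h1 : ι (Sum.inr (Sum.inl (e.map β, ⟨0, by omega⟩))) ∈ pairEdge ι (e.map β) := by simp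
      rw [heq] at h1
      simpa using h1
    induction e with
    | _ a b =>
    induction e' with
    | _ a' b' =>
    have ha := heA a (by simp)
    have hb := heA b (by simp)
    have ha' := heA' a' (by simp)
    have hb' := heA' b' (by simp)
    simp only [Sym2.map_mk, Sym2.eq_iff] at hz ⊢
    rcases hz with ⟨h, h'⟩ | ⟨h, h'⟩
    · exact Or.inl ⟨hβ ha ha' h, hβ hb hb' h'⟩
    · exact Or.inr ⟨hβ ha hb' h, hβ hb ha' h'⟩
  · intro v hv b hb
    obtain ⟨p, rfl⟩ := hX b hb
    have hQ : ((A.filter (F.Adj v)).image β).card ≤ d :=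
      Finset.card_image_le.trans (hAd v hv _ (Finset.filter_subset _ _)
        (fun a ha => (Finset.mem_filter.mp ha).2))
    -- Distinct kernels containing the images of the neighbours of `v` in `A`; joined to the petal
    -- of `b`, they give distinct hyperedges.
    obtain ⟨σ, hσ, hσS⟩ := hrep _ hQ
    have hmem : ∀ a ∈ A, F.Adj v a → β a ∈ (A.filter (F.Adj v)).image β := fun a ha hva =>
      Finset.mem_image_of_mem _ (Finset.mem_filter.mpr ⟨ha, hva⟩)
    refine ⟨fun a => petalEdge S ι (σ (β a)) p.1, ?_, ?_⟩
    · intro a ha hva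
      refine ⟨hpetmem _ _, ?_, by simp, ?_⟩
      · simpa using hσS _ (hmem a ha hva)
      · intro y hy hyX
        obtain ⟨p', rfl⟩ := hX y hyX
        simp only [petal_mem_petalEdge] at hy
        simp [hy]
    · intro a ha hva a' ha' hva' heq
      have heq' : petalEdge S ι (σ (β a)) p.1 = petalEdge S ι (σ (β a')) p.1 := heq
      have hSS : S (σ (β a)) = S (σ (β a')) := by
        ext y
        rw [← core_mem_petalEdge S ι (j := p.1), heq', core_mem_petalEdge]
      exact hβ ha ha' (hσ (hmem a ha hva) (hmem a' ha' hva') (hSinj hSS))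
  · intro n
    by_cases hn : n < N
    · have : (Finset.univ \ X).filter (fun v => petalLabel ι v = n) ⊆
          Finset.univ.image (fun i : Fin s => ι (Sum.inr (Sum.inr (⟨n, hn⟩, i)))) := by
        intro v hv
        obtain ⟨hvX, hvn⟩ := Finset.mem_filter.mp hv
        obtain ⟨⟨a, b⟩, rfl⟩ := hX v (Finset.mem_sdiff.mp hvX).2
        simp only [petalLabel_apply] at hvn
        exact Finset.mem_image.mpr ⟨b, Finset.mem_univ _, by simp [← hvn]⟩
      have := (Finset.card_le_card this).trans Finset.card_image_le
      simpa using this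
    · have : (Finset.univ \ X).filter (fun v => petalLabel ι v = n) = ∅ := by
        refine Finset.eq_empty_of_forall_notMem fun v hv => ?_
        obtain ⟨hvX, hvn⟩ := Finset.mem_filter.mp hv
        obtain ⟨p, rfl⟩ := hX v (Finset.mem_sdiff.mp hvX).2
        simp only [petalLabel_apply] at hvn
        exact hn (hvn ▸ p.1.2)
      simp [this]

end Petals

/-! ### Criteria for linear saturation -/

/-- For all large `n` there is a Berge-`F`-saturated hypergraph with at most `C * n` hyperedges. -/
def HasLinearSaturation {W : Type*} (k : ℕ) (F : SimpleGraph W) : Prop :=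
  ∃ C n₀ : ℕ, ∀ n ≥ n₀, ∃ H : UniformHypergraph k (Fin n),
    H.IsBergeSaturated F ∧ H.edges.card ≤ C * n

theorem hasLinearSaturation_of_not_petalDecomposable {W : Type*} [Fintype W] {k t q s d : ℕ}
    (hk : 3 ≤ k) (S : Fin q → Finset (Fin t)) (hS : ∀ i, (S i).card + s = k)
    (hSinj : Function.Injective S) (ht : 0 < t) (hs : 0 < s)
    (hrep : ∀ Q : Finset (Fin t), Q.card ≤ d → ∃ σ : Fin t → Fin q, Set.InjOn σ Q ∧
      ∀ a ∈ Q, a ∈ S (σ a))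
    {F : SimpleGraph W} {A K : Finset W} (hA : HitsTwoCores F A) (hAt : A.card ≤ t)
    (hAd : ∀ v, v ∉ A → ∀ Q ⊆ A, (∀ a ∈ Q, F.Adj v a) → Q.card ≤ d)
    (hK : IsTwoCore F K) (hdec : ¬ PetalDecomposable F K t s q) :
    HasLinearSaturation k F := by
  set b := t + Fintype.card (Sym2 (Fin t)) * (k - 2) with hb
  -- Here `b` counts core and private vertices. Fewer than `s` further vertices miss the petals, so
  -- `b + s` bounds the set outside them.
  refine ⟨2 ^ (b + s + Fintype.card W * (k * s)) + 1 + 2 ^ (b + s), b + 1, fun n hn => ?_⟩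
  have hdiv := Nat.div_add_mod (n - b) s
  have hmod := Nat.mod_lt (n - b) hs
  rw [mul_comm] at hdiv
  obtain ⟨ι⟩ : Nonempty (Fin t ⊕ (Sym2 (Fin t) × Fin (k - 2)) ⊕ (Fin ((n - b) / s) × Fin s) ↪
      Fin n) := by
    refine Function.Embedding.nonempty_of_card_le ?_
    simp only [Fintype.card_sum, Fintype.card_prod, Fintype.card_fin]
    omega
  have hfree : ¬ (petalHypergraph (by omega : 2 ≤ k) S hS ι).ContainsBerge F := fun h =>
    hdec (petalDecomposable_of_containsBerge S ι hK h)
  obtain ⟨H, hsub, hH⟩ := UniformHypergraph.exists_isBergeSaturated_ge _ hfree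
  refine ⟨H, hH, ?_⟩
  have h := card_edges_le_of_petalHypergraph_le S ι hk hSinj ht (x := b + s) hrep hA hAt hAd
    (by rw [Fintype.card_fin]; omega) hsub hH.1
  rw [Fintype.card_fin] at h
  refine h.trans ?_
  rw [add_mul (_ + 1)]
  exact Nat.add_le_add_left (Nat.le_mul_of_pos_right _ (by omega)) _

theorem hasLinearSaturation_of_forest {W : Type*} [Fintype W] {k : ℕ} {F : SimpleGraph W}
    (hF : F ≠ ⊥) (hforest : HitsTwoCores F ∅) : HasLinearSaturation k F := by
  refine ⟨2 ^ (Fintype.card W * (k * 1)) + 1 + 1, 1, fun n hn => ?_⟩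
  obtain ⟨H, -, hH⟩ := UniformHypergraph.exists_isBergeSaturated_ge (V := Fin n)
    (⟨∅, by simp⟩ : UniformHypergraph k (Fin n))
    (UniformHypergraph.not_containsBerge_of_edges_eq_empty hF rfl)
  refine ⟨H, hH, ?_⟩
  by_contra hcon
  obtain ⟨U, hU, hUX, hdeg⟩ := exists_dense_subset H ∅ (Fintype.card W * (k * 1)) (by
    rw [Fintype.card_fin, Finset.card_empty, pow_zero]
    rw [add_mul (_ + 1)] at hcon
    omega)
  -- With no core, every vertex is its own class.
  refine hH.1 (containsBerge_of_dense (l := Fin.val) (s := 1) (X := ∅) (U := U) hforest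
    (fun _ => ⟨0, hn⟩) (by simp) (by simp) (fun _ => ∅) ?_ ?_ ?_ ?_ hUX hU (by simpa using hdeg))
  · intro e he heA
    induction e with
    | _ a b => exact absurd (heA a (by simp)) (by simp)
  · intro e he heA
    induction e with
    | _ a b => exact absurd (heA a (by simp)) (by simp)
  · intro v _ b _
    exact ⟨fun _ => ∅, by simp, by simp⟩
  · intro c
    refine Finset.card_le_one.mpr fun a ha b hb => ?_
    simp only [Finset.mem_filter] at ha hb
    exact Fin.ext (ha.2.trans hb.2.symm)

/-! ### Two-cores, vertex covers and petal decompositions -/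

section TwoCores

variable {W : Type*} {F : SimpleGraph W}

/-- `C` meets every edge of `F` inside `K`. -/
def CoversEdges (F : SimpleGraph W) (K C : Finset W) : Prop :=
  ∀ u ∈ K, ∀ v ∈ K, F.Adj u v → u ∈ C ∨ v ∈ C

theorem exists_greatest_isTwoCore [Fintype W] (F : SimpleGraph W) :
    ∃ K, IsTwoCore F K ∧ ∀ Y, IsTwoCore F Y → Y ⊆ K := by
  classical
  have hsub : ∀ Y, IsTwoCore F Y → Y ⊆ Finset.univ.filter (fun v => ∃ Y, IsTwoCore F Y ∧ v ∈ Y) :=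
    fun Y hY y hy => Finset.mem_filter.mpr ⟨Finset.mem_univ _, Y, hY, hy⟩
  refine ⟨_, fun y hy => ?_, hsub⟩
  obtain ⟨Y, hY, hyY⟩ := (Finset.mem_filter.mp hy).2
  obtain ⟨a, ha, b, hb, h⟩ := hY y hyY
  exact ⟨a, hsub Y hY ha, b, hsub Y hY hb, h⟩

theorem IsTwoCore.exists_adj_ne {K : Finset W} (hK : IsTwoCore F K) {u : W} (hu : u ∈ K) (v : W) :
    ∃ x ∈ K, x ≠ v ∧ F.Adj u x := by
  obtain ⟨a, ha, b, hb, hab, hua, hub⟩ := hK u hu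
  by_cases h : a = v
  · exact ⟨b, hb, fun h' => hab (h.trans h'.symm), hub⟩
  · exact ⟨a, ha, h, hua⟩

theorem exists_minimum_hitsTwoCores [Fintype W] {K : Finset W}
    (hKmax : ∀ Y, IsTwoCore F Y → Y ⊆ K) :
    ∃ A ⊆ K, HitsTwoCores F A ∧ ∀ B, HitsTwoCores F B → A.card ≤ B.card := by
  classical
  have hne : (Finset.univ.filter (fun A : Finset W => HitsTwoCores F A)).Nonempty :=
    ⟨Finset.univ, Finset.mem_filter.mpr ⟨Finset.mem_univ _, fun Y _ ⟨y, hy⟩ =>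
      ⟨y, hy, Finset.mem_univ _⟩⟩⟩
  obtain ⟨A, hA, hmin⟩ := Finset.exists_min_image _ Finset.card hne
  simp only [Finset.mem_filter, Finset.mem_univ, true_and] at hA hmin
  refine ⟨A ∩ K, Finset.inter_subset_right, fun Y hY hne => ?_, fun B hB =>
    (Finset.card_le_card Finset.inter_subset_left).trans (hmin B hB)⟩
  obtain ⟨y, hy, hyA⟩ := hA Y hY hne
  exact ⟨y, hy, Finset.mem_inter.mpr ⟨hyA, hKmax Y hY hy⟩⟩

theorem exists_minimum_coversEdges [Fintype W] (F : SimpleGraph W) (K : Finset W) :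
    ∃ C, CoversEdges F K C ∧ ∀ B, CoversEdges F K B → C.card ≤ B.card := by
  classical
  have hne : (Finset.univ.filter (fun A : Finset W => CoversEdges F K A)).Nonempty :=
    ⟨Finset.univ, Finset.mem_filter.mpr ⟨Finset.mem_univ _, fun _ _ _ _ _ =>
      Or.inl (Finset.mem_univ _)⟩⟩
  obtain ⟨A, hA, hmin⟩ := Finset.exists_min_image _ Finset.card hne
  simp only [Finset.mem_filter, Finset.mem_univ, true_and] at hA hmin
  exact ⟨A, hA, hmin⟩

theorem CoversEdges.mono {K Y C : Finset W} (h : CoversEdges F K C) (hY : Y ⊆ K) :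
    CoversEdges F Y C := fun u hu v hv => h u (hY hu) v (hY hv)

/-- A two-core always has an edge avoiding `x`, and some endpoint of it lies in `C`. This makes
minimum hitting sets strictly smaller than minimum covers. -/
theorem CoversEdges.exists_mem_erase [DecidableEq W] {Y C : Finset W} (hC : CoversEdges F Y C)
    (hY : IsTwoCore F Y) (hne : Y.Nonempty) (x : W) : ∃ y ∈ Y, y ∈ C.erase x := by
  by_contra hcon
  push Not at hcon
  simp only [Finset.mem_erase, not_and, not_imp_not] at hcon
  obtain ⟨y, hy, hyx⟩ : ∃ y ∈ Y, y ≠ x := by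
    obtain ⟨y, hy⟩ := hne
    obtain ⟨a, ha, hay, -⟩ := hY.exists_adj_ne hy x
    exact ⟨a, ha, hay⟩
  obtain ⟨a, ha, hax, hya⟩ := hY.exists_adj_ne hy x
  rcases hC y hy a ha hya with h | h
  · exact hyx (hcon y hy h)
  · exact hax (hcon a ha h)

theorem CoversEdges.hitsTwoCores_erase [DecidableEq W] {K C : Finset W}
    (hKmax : ∀ Y, IsTwoCore F Y → Y ⊆ K) (hC : CoversEdges F K C) (x : W) :
    HitsTwoCores F (C.erase x) := fun Y hY hne =>
  (hC.mono (hKmax Y hY)).exists_mem_erase hY hne x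

/-- Petal decompositions into classes that are too small to contain an edge are vertex covers. -/
theorem PetalDecomposable.exists_coversEdges {K : Finset W} {t s q : ℕ} (hK : IsTwoCore F K)
    (h : PetalDecomposable F K t s q) (hsq : s ≤ 1 ∨ q ≤ 2) :
    ∃ C, CoversEdges F K C ∧ C.card ≤ t := by
  classical
  obtain ⟨A, c, -, hAt, hc, hs, hq⟩ := h
  refine ⟨A, fun u hu v hv huv => ?_, hAt⟩
  by_contra hcon
  push Not at hcon
  have hcuv := hc u hu v hv hcon.1 hcon.2 huv
  -- An uncovered edge `uv` puts two vertices in one class; a second edge at each end makes three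
  -- edges touching it.
  rcases hsq with hs1 | hq2
  · have h1 := hs (c u) {u, v} (by
      intro y hy
      rcases Finset.mem_insert.mp hy with rfl | hy
      · exact ⟨hu, hcon.1, rfl⟩
      · rw [Finset.mem_singleton.mp hy]
        exact ⟨hv, hcon.2, hcuv.symm⟩)
    rw [Finset.card_pair huv.ne] at h1
    omega
  · obtain ⟨x, hx, hxv, hux⟩ := hK.exists_adj_ne hu v
    obtain ⟨y, hy, hyu, hvy⟩ := hK.exists_adj_ne hv u
    have h1 := hq (c u) {s(u, v), s(u, x), s(v, y)} (by
      simp only [Finset.mem_insert, Finset.mem_singleton, forall_eq_or_imp, forall_eq,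
        SimpleGraph.mem_edgeSet, Sym2.mem_iff, exists_eq_or_imp, exists_eq_left, huv, hux, hvy]
      simp_all)
    rw [Finset.card_eq_three.mpr ⟨s(u, v), s(u, x), s(v, y), by simp_all [huv.ne, huv.ne', eq_comm],
      by simp_all [huv.ne, huv.ne', eq_comm], by simp_all [huv.ne, huv.ne', eq_comm], rfl⟩] at h1
    omega

/-- `u, v, w` span a triangle which is a component of the subgraph induced on `K`. -/
def IsTriangleComponent (F : SimpleGraph W) (K : Finset W) (u v w : W) : Prop :=
  (u ∈ K ∧ v ∈ K ∧ w ∈ K) ∧ (F.Adj u v ∧ F.Adj u w ∧ F.Adj v w) ∧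
    ∀ x ∈ K, ∀ y, y = u ∨ y = v ∨ y = w → F.Adj y x → x = u ∨ x = v ∨ x = w

/-- Since `K` minus `A` is a matching, `A` is a minimum hitting set. Minimality puts each of its
vertices in a triangle with a matching edge; these triangles are disjoint, and a cover takes two
vertices of each. -/
theorem two_mul_le_card_of_matching {K A C : Finset W} {c : W → ℕ} {t : ℕ}
    (hKmax : ∀ Y, IsTwoCore F Y → Y ⊆ K) (hmin : ∀ B, HitsTwoCores F B → t ≤ B.card)
    (hAt : A.card ≤ t) (hAK : A ⊆ K)
    (hm : ∀ u ∈ K, ∀ v ∈ K, ∀ w ∈ K, u ∉ A → v ∉ A → w ∉ A → F.Adj u v → F.Adj u w → v = w)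
    (hc : ∀ u ∈ K, ∀ v ∈ K, u ∉ A → v ∉ A → F.Adj u v → c u = c v)
    (hq : ∀ n, ∀ E : Finset (Sym2 W), (∀ e ∈ E, e ∈ F.edgeSet ∧ (∀ w ∈ e, w ∈ K) ∧
      ∃ w ∈ e, w ∉ A ∧ c w = n) → E.card ≤ 4)
    (hC : CoversEdges F K C) : 2 * t ≤ C.card := by
  classical
  have hA : A.card = t := by
    refine le_antisymm hAt (hmin A fun Y hY ⟨y, hy⟩ => ?_)
    by_contra hcon
    push Not at hcon
    obtain ⟨a, ha, b, hb, hab, hya, hyb⟩ := hY y hy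
    have hYK := hKmax Y hY
    exact hab (hm y (hYK hy) a (hYK ha) b (hYK hb) (hcon y hy) (hcon a ha) (hcon b hb) hya hyb)
  -- Some two-core meets `A` only in `a`. Its other vertices have at most one neighbour outside `A`,
  -- so each is also adjacent to `a`.
  have htri : ∀ a ∈ A, ∃ y z, y ∈ K ∧ z ∈ K ∧ y ∉ A ∧ z ∉ A ∧ F.Adj y a ∧ F.Adj z a ∧
      F.Adj y z := by
    intro a ha
    have hnot : ¬ HitsTwoCores F (A.erase a) := by
      intro h
      have h1 := hmin _ h
      have h2 := Finset.card_erase_add_one ha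
      omega
    simp only [HitsTwoCores, not_forall, not_exists, not_and, Finset.mem_erase, exists_prop] at hnot
    obtain ⟨Y, hY, ⟨y₀, hy₀⟩, hYA⟩ := hnot
    have hYA' : ∀ y ∈ Y, y ≠ a → y ∉ A := hYA
    have hYK := hKmax Y hY
    have step : ∀ y ∈ Y, y ∉ A → F.Adj y a ∧ ∃ z ∈ Y, z ∉ A ∧ F.Adj y z := by
      intro y hy hyA
      obtain ⟨z, hz, hza, hyz⟩ := hY.exists_adj_ne hy a
      obtain ⟨b, hb, hbz, hyb⟩ := hY.exists_adj_ne hy z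
      have hzA := hYA' z hz hza
      have hba : b = a := by
        by_contra hba
        exact hbz (hm y (hYK hy) b (hYK hb) z (hYK hz) hyA (hYA' b hb hba) hzA hyb hyz)
      exact ⟨hba ▸ hyb, z, hz, hzA, hyz⟩
    obtain ⟨y, hy, hya, -⟩ := hY.exists_adj_ne hy₀ a
    obtain ⟨hadj, z, hz, hzA, hyz⟩ := step y hy (hYA' y hy hya)
    exact ⟨y, z, hYK hy, hYK hz, hYA' y hy hya, hzA, hadj, (step z hz hzA).1, hyz⟩
  choose! y z hyK hzK hyA hzA hya hza hyz using htri
  -- A matching edge shared by two triangles would make five edges touch its class.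
  have hdisj : ∀ a ∈ A, ∀ b ∈ A, ∀ p ∈ K, ∀ r ∈ K, p ∉ A → r ∉ A → F.Adj p r → F.Adj p a →
      F.Adj r a → F.Adj p b → F.Adj r b → a = b := by
    intro a ha b hb p hp r hr hpA hrA hpr hpa hra hpb hrb
    by_contra hab
    have h1 := hq (c p) {s(p, r), s(p, a), s(r, a), s(p, b), s(r, b)} (by
      have haK := hAK ha
      have hbK := hAK hb
      have hcc := hc p hp r hr hpA hrA hpr
      simp only [Finset.mem_insert, Finset.mem_singleton, forall_eq_or_imp, forall_eq,
        SimpleGraph.mem_edgeSet, Sym2.mem_iff, exists_eq_or_imp, exists_eq_left]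
      simp_all)
    have h2 : ({s(p, r), s(p, a), s(r, a), s(p, b), s(r, b)} : Finset (Sym2 W)).card = 5 := by
      have := hpr.ne; have := hpa.ne; have := hra.ne; have := hpb.ne; have := hrb.ne
      have := hpr.ne'; have := hpa.ne'; have := hra.ne'; have := hpb.ne'; have := hrb.ne'
      have := Ne.symm hab
      repeat rw [Finset.card_insert_of_notMem]
      · simp
      all_goals
        simp only [Finset.mem_insert, Finset.mem_singleton, Sym2.eq_iff]
        tauto
    omega
  let T : W → Finset W := fun a => {a, y a, z a} ∩ C
  have hT : (A.biUnion T).card = ∑ a ∈ A, (T a).card := by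
    refine Finset.card_biUnion fun a ha b hb hab => ?_
    refine Finset.disjoint_left.mpr fun x hx hx' => hab ?_
    have hx1 := (Finset.mem_inter.mp hx).1
    have hx2 := (Finset.mem_inter.mp hx').1
    simp only [Finset.mem_insert, Finset.mem_singleton] at hx1 hx2
    rcases hx1 with rfl | h1 | h1 <;> rcases hx2 with h2 | h2 | h2
    · exact h2
    · exact absurd ha (h2 ▸ hyA b hb)
    · exact absurd ha (h2 ▸ hzA b hb)
    · exact absurd (h2.symm.trans h1 ▸ hb) (hyA a ha)
    · have e1 : y a = y b := h1.symm.trans h2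
      have e2 : z a = z b := hm (y a) (hyK a ha) (z a) (hzK a ha) (z b) (hzK b hb) (hyA a ha)
        (hzA a ha) (hzA b hb) (hyz a ha) (e1 ▸ hyz b hb)
      exact hdisj a ha b hb _ (hyK a ha) _ (hzK a ha) (hyA a ha) (hzA a ha) (hyz a ha) (hya a ha)
        (hza a ha) (e1 ▸ hya b hb) (e2 ▸ hza b hb)
    · have e1 : y a = z b := h1.symm.trans h2
      have e2 : z a = y b := hm (y a) (hyK a ha) (z a) (hzK a ha) (y b) (hyK b hb) (hyA a ha)
        (hzA a ha) (hyA b hb) (hyz a ha) (e1 ▸ (hyz b hb).symm)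
      exact hdisj a ha b hb _ (hyK a ha) _ (hzK a ha) (hyA a ha) (hzA a ha) (hyz a ha) (hya a ha)
        (hza a ha) (e1 ▸ hza b hb) (e2 ▸ hya b hb)
    · exact absurd (h2.symm.trans h1 ▸ hb) (hzA a ha)
    · have e1 : z a = y b := h1.symm.trans h2
      have e2 : y a = z b := hm (z a) (hzK a ha) (y a) (hyK a ha) (z b) (hzK b hb) (hzA a ha)
        (hyA a ha) (hzA b hb) (hyz a ha).symm (e1 ▸ hyz b hb)
      exact hdisj a ha b hb _ (hyK a ha) _ (hzK a ha) (hyA a ha) (hzA a ha) (hyz a ha) (hya a ha)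
        (hza a ha) (e2 ▸ hza b hb) (e1 ▸ hya b hb)
    · have e1 : z a = z b := h1.symm.trans h2
      have e2 : y a = y b := hm (z a) (hzK a ha) (y a) (hyK a ha) (y b) (hyK b hb) (hzA a ha)
        (hyA a ha) (hyA b hb) (hyz a ha).symm (e1 ▸ (hyz b hb).symm)
      exact hdisj a ha b hb _ (hyK a ha) _ (hzK a ha) (hyA a ha) (hzA a ha) (hyz a ha) (hya a ha)
        (hza a ha) (e2 ▸ hya b hb) (e1 ▸ hza b hb)
  have hT2 : ∀ a ∈ A, 2 ≤ (T a).card := by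
    intro a ha
    have h1 := hC _ (hyK a ha) _ (hAK ha) (hya a ha)
    have h2 := hC _ (hzK a ha) _ (hAK ha) (hza a ha)
    have h3 := hC _ (hyK a ha) _ (hzK a ha) (hyz a ha)
    have n1 := (hya a ha).ne
    have n2 := (hza a ha).ne
    have n3 := (hyz a ha).ne
    refine Finset.one_lt_card.mpr ?_
    simp only [T, Finset.mem_inter, Finset.mem_insert, Finset.mem_singleton]
    by_cases hy : y a ∈ C
    · rcases h2 with h | h
      · exact ⟨y a, ⟨by simp, hy⟩, z a, ⟨by simp, h⟩, n3⟩
      · exact ⟨y a, ⟨by simp, hy⟩, a, ⟨by simp, h⟩, n1⟩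
    · exact ⟨z a, ⟨by simp, h3.resolve_left hy⟩, a, ⟨by simp, h1.resolve_left hy⟩, n2⟩
  have hsub : A.biUnion T ⊆ C := Finset.biUnion_subset.mpr fun a _ => Finset.inter_subset_right
  have h1 := Finset.card_le_card hsub
  have h2 := Finset.card_nsmul_le_sum A (fun a => (T a).card) 2 hT2
  rw [smul_eq_mul, hA] at h2
  omega

/-- It suffices that `K` minus `A` is a matching. A path on three vertices there lies in one class,
so `s ≥ 3`; if `q ≤ 3`, its ends' further edges must coincide, closing an isolated triangle. -/
theorem PetalDecomposable.two_mul_le_card {K C : Finset W} {t s q : ℕ} (hK : IsTwoCore F K)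
    (hKmax : ∀ Y, IsTwoCore F Y → Y ⊆ K) (hmin : ∀ B, HitsTwoCores F B → t ≤ B.card)
    (h : PetalDecomposable F K t s q) (hq4 : q ≤ 4)
    (hsq : s ≤ 2 ∨ q ≤ 3 ∧ ∀ u v w, ¬ IsTriangleComponent F K u v w)
    (hC : CoversEdges F K C) : 2 * t ≤ C.card := by
  classical
  obtain ⟨A, c, hAK, hAt, hc, hs, hq⟩ := h
  refine two_mul_le_card_of_matching hKmax hmin hAt hAK ?_ hc
    (fun n E hE => (hq n E hE).trans hq4) hC
  intro u hu v hv w hw huA hvA hwA huv huw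
  by_contra hvw
  have hcv := hc u hu v hv huA hvA huv
  have hcw := hc u hu w hw huA hwA huw
  rcases hsq with hs2 | ⟨hq3, hno⟩
  · have h1 := hs (c u) {u, v, w} (by
      simp only [Finset.mem_insert, Finset.mem_singleton, forall_eq_or_imp, forall_eq]
      exact ⟨⟨hu, huA, trivial⟩, ⟨hv, hvA, hcv.symm⟩, ⟨hw, hwA, hcw.symm⟩⟩)
    rw [Finset.card_eq_three.mpr ⟨u, v, w, huv.ne, huw.ne, hvw, rfl⟩] at h1
    omega
  · have key : ∀ e₁ e₂ e₃ e₄ : Sym2 W, e₁ ≠ e₂ → e₁ ≠ e₃ → e₂ ≠ e₃ →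
        (∀ e, e = e₁ ∨ e = e₂ ∨ e = e₃ ∨ e = e₄ → e ∈ F.edgeSet ∧ (∀ w ∈ e, w ∈ K) ∧
          ∃ w ∈ e, w ∉ A ∧ c w = c u) → e₄ = e₁ ∨ e₄ = e₂ ∨ e₄ = e₃ := by
      intro e₁ e₂ e₃ e₄ h12 h13 h23 he
      by_contra hcon
      push Not at hcon
      have h1 := hq (c u) {e₄, e₁, e₂, e₃} (by
        intro e hmem
        simp only [Finset.mem_insert, Finset.mem_singleton] at hmem
        exact he e (by tauto))
      rw [Finset.card_insert_of_notMem (by simpa using hcon),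
        Finset.card_eq_three.mpr ⟨e₁, e₂, e₃, h12, h13, h23, rfl⟩] at h1
      omega
    have touch : ∀ p ∈ K, ∀ r ∈ K, F.Adj p r → p ∉ A → c p = c u →
        s(p, r) ∈ F.edgeSet ∧ (∀ w ∈ s(p, r), w ∈ K) ∧ ∃ w ∈ s(p, r), w ∉ A ∧ c w = c u := by
      intro p hp r hr hpr hpA hcp
      refine ⟨hpr, fun w hw => ?_, p, by simp, hpA, hcp⟩
      rcases Sym2.mem_iff.mp hw with rfl | rfl <;> assumption
    have n1 := huv.ne
    have n2 := huw.ne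
    have n1' := huv.ne'
    have n2' := huw.ne'
    have n3 := Ne.symm hvw
    obtain ⟨x, hx, hxu, hvx⟩ := hK.exists_adj_ne hv u
    obtain ⟨y, hy, hyu, hwy⟩ := hK.exists_adj_ne hw u
    have h1 := key s(u, v) s(u, w) s(v, x) s(w, y)
      (by rw [Ne, Sym2.eq_iff]; tauto)
      (by rw [Ne, Sym2.eq_iff]; rintro (h | h) <;> [exact n1 h.1; exact hxu h.1.symm])
      (by rw [Ne, Sym2.eq_iff]; rintro (h | h) <;> [exact n1 h.1; exact hxu h.1.symm])
      (by
        rintro e (rfl | rfl | rfl | rfl)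
        · exact touch u hu v hv huv huA rfl
        · exact touch u hu w hw huw huA rfl
        · exact touch v hv x hx hvx hvA hcv.symm
        · exact touch w hw y hy hwy hwA hcw.symm)
    have hxw : x = w := by
      simp only [Sym2.eq_iff] at h1
      rcases h1 with (⟨h, -⟩ | ⟨h, -⟩) | (⟨h, -⟩ | ⟨-, h⟩) | (⟨h, -⟩ | ⟨h, -⟩)
      · exact absurd h n2'
      · exact absurd h n3
      · exact absurd h n2'
      · exact absurd h hyu
      · exact absurd h n3
      · exact h.symm
    subst hxw
    refine hno u v x ⟨⟨hu, hv, hw⟩, ⟨huv, huw, hvx⟩, ?_⟩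
    intro r hr p hp hpr
    have h2 := key s(u, v) s(u, x) s(v, x) s(p, r)
      (by rw [Ne, Sym2.eq_iff]; tauto)
      (by rw [Ne, Sym2.eq_iff]; tauto)
      (by rw [Ne, Sym2.eq_iff]; tauto)
      (by
        rintro e (rfl | rfl | rfl | rfl)
        · exact touch u hu v hv huv huA rfl
        · exact touch u hu x hw huw huA rfl
        · exact touch v hv x hx hvx hvA hcv.symm
        · rcases hp with rfl | rfl | rfl
          · exact touch _ hu r hr hpr huA rfl
          · exact touch _ hv r hr hpr hvA hcv.symm
          · exact touch _ hw r hr hpr hwA hcw.symm)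
    simp only [Sym2.eq_iff] at h2
    grind

/-- A cover uses two vertices of the triangle, whereas a hitting set needs one there and can drop a
vertex of the cover elsewhere. -/
theorem IsTriangleComponent.card_add_two_le [DecidableEq W] {K A C : Finset W} {u v w : W}
    (hT : IsTriangleComponent F K u v w) (hKmax : ∀ Y, IsTwoCore F Y → Y ⊆ K)
    (hmin : ∀ B, HitsTwoCores F B → A.card ≤ B.card) (hA : 2 ≤ A.card)
    (hC : CoversEdges F K C) : A.card + 2 ≤ C.card := by
  obtain ⟨⟨hu, hv, hw⟩, ⟨huv, huw, hvw⟩, hiso⟩ := hT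
  have hCT : 2 ≤ (C ∩ {u, v, w}).card := by
    refine Finset.one_lt_card.mpr ?_
    have h1 := hC u hu v hv huv
    have h2 := hC u hu w hw huw
    have h3 := hC v hv w hw hvw
    simp only [Finset.mem_inter, Finset.mem_insert, Finset.mem_singleton]
    by_cases huC : u ∈ C
    · rcases h3 with h | h
      · exact ⟨u, ⟨huC, by simp⟩, v, ⟨h, by simp⟩, huv.ne⟩
      · exact ⟨u, ⟨huC, by simp⟩, w, ⟨h, by simp⟩, huw.ne⟩
    · exact ⟨v, ⟨h1.resolve_left huC, by simp⟩, w, ⟨h2.resolve_left huC, by simp⟩, hvw.ne⟩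
  have hhit : ∀ x, HitsTwoCores F (insert u ((C \ {u, v, w}).erase x)) := by
    intro x Y hY hne
    have hYK := hKmax Y hY
    by_cases huY : u ∈ Y
    · exact ⟨u, huY, Finset.mem_insert_self _ _⟩
    · have hvwY : ∀ y ∈ Y, y ≠ v ∧ y ≠ w := by
        intro y hy
        by_contra hyvw
        obtain ⟨a, ha, b, hb, hab, hya, hyb⟩ := hY y hy
        have e1 := hiso a (hYK ha) y (by tauto) hya
        have e2 := hiso b (hYK hb) y (by tauto) hyb
        have : a ≠ y := hya.ne'
        have : b ≠ y := hyb.ne'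
        have : a ≠ u := fun h => huY (h ▸ ha)
        have : b ≠ u := fun h => huY (h ▸ hb)
        grind
      have hcov : CoversEdges F Y (C \ {u, v, w}) := by
        intro a ha b hb hab
        have := hvwY a ha
        have := hvwY b hb
        have : a ≠ u := fun h => huY (h ▸ ha)
        have : b ≠ u := fun h => huY (h ▸ hb)
        have := hC a (hYK ha) b (hYK hb) hab
        simp only [Finset.mem_sdiff, Finset.mem_insert, Finset.mem_singleton]
        tauto
      obtain ⟨y, hy, hy'⟩ := hcov.exists_mem_erase hY hne x
      exact ⟨y, hy, Finset.mem_insert_of_mem hy'⟩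
  have hcard := Finset.card_sdiff_add_card_inter C {u, v, w}
  -- If nothing of `C` remains to be erased, `{u}` is a hitting set, contradicting `2 ≤ A.card`.
  rcases (C \ {u, v, w}).eq_empty_or_nonempty with h | ⟨x, hx⟩
  · have h1 := hmin _ (hhit u)
    rw [h] at h1
    simp at h1
    omega
  · have h1 := (hmin _ (hhit x)).trans (Finset.card_insert_le _ _)
    have h2 := Finset.card_erase_add_one hx
    omega

end TwoCores

/-! ### Choice of kernels -/

/-- There are `t` distinct `r`-subsets of a `t`-set, the `a`-th one containing `a`. -/
theorem exists_kernels {r t : ℕ} (hr : 1 ≤ r) (hrt : r = 1 ∨ r + 1 ≤ t) :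
    ∃ S : Fin t → Finset (Fin t), Function.Injective S ∧ (∀ a, (S a).card = r) ∧ ∀ a, a ∈ S a := by
  rcases hrt with rfl | hrt
  · exact ⟨fun a => {a}, Finset.singleton_injective, by simp, by simp⟩
  · induction t, hrt using Nat.le_induction with
    | base =>
      have hne : ∀ a : Fin (r + 1), a ≠ a + 1 := by
        intro a h
        have h1 : (1 : Fin (r + 1)) = 0 := by simpa using h.symm
        have := congrArg Fin.val h1
        rw [Fin.val_one', Nat.mod_eq_of_lt (by omega)] at this
        simp at this
      -- For `t = r + 1`, omit the cyclic successor of `a`.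
      refine ⟨fun a => Finset.univ.erase (a + 1), ?_, by simp, fun a => by simpa using hne a⟩
      intro a b hab
      by_contra hcon
      have h1 : a + 1 ∈ Finset.univ.erase (b + 1) := by simpa using hcon
      rw [← show Finset.univ.erase (a + 1) = Finset.univ.erase (b + 1) from hab] at h1
      simp at h1
    | succ t ht ih =>
      obtain ⟨S, hinj, hcard, hmem⟩ := ih
      obtain ⟨R, -, hR⟩ := Finset.exists_subset_card_eq
        (s := (Finset.univ : Finset (Fin t))) (n := r - 1) (by simp; omega)
      have hlast : ∀ X : Finset (Fin t), Fin.last t ∉ X.map Fin.castSuccEmb := by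
        intro X h
        obtain ⟨a, -, ha⟩ := Finset.mem_map.mp h
        exact (Fin.castSucc_lt_last a).ne ha
      refine ⟨Fin.lastCases (insert (Fin.last t) (R.map Fin.castSuccEmb))
        (fun a => (S a).map Fin.castSuccEmb), ?_, ?_, ?_⟩
      · intro a b
        induction a using Fin.lastCases <;> induction b using Fin.lastCases
        · simp
        · intro h
          simp only [Fin.lastCases_last, Fin.lastCases_castSucc] at h
          exact absurd (h ▸ Finset.mem_insert_self _ _) (hlast _)
        · intro h
          simp only [Fin.lastCases_last, Fin.lastCases_castSucc] at h
          exact absurd (h.symm ▸ Finset.mem_insert_self _ _) (hlast _)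
        · intro h
          simp only [Fin.lastCases_castSucc, Finset.map_inj] at h
          rw [hinj h]
      · intro a
        induction a using Fin.lastCases
        · simp only [Fin.lastCases_last]
          rw [Finset.card_insert_of_notMem (hlast R), Finset.card_map, hR]
          omega
        · simp [hcard]
      · intro a
        induction a using Fin.lastCases
        · simp
        · simp [hmem]

/-! ### Choice of parameters and conclusion -/

section Cases

variable {W : Type*} [Fintype W] {F : SimpleGraph W}

theorem hasLinearSaturation_of_full {k r s t : ℕ} (hk : 3 ≤ k) (hrs : r + s = k) (hr : 1 ≤ r)
    (hs : 0 < s) (hrt : r = 1 ∨ r + 1 ≤ t) (ht : 0 < t) {A K : Finset W} (hA : HitsTwoCores F A)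
    (hAt : A.card ≤ t) (hK : IsTwoCore F K) (hdec : ¬ PetalDecomposable F K t s t) :
    HasLinearSaturation k F := by
  obtain ⟨S, hinj, hcard, hmem⟩ := exists_kernels hr hrt
  exact hasLinearSaturation_of_not_petalDecomposable (d := t) hk S (fun i => by rw [hcard, hrs])
    hinj ht hs (fun Q _ => ⟨id, Set.injOn_id _, fun a _ => hmem a⟩) hA hAt
    (fun v _ Q hQ _ => (Finset.card_le_card hQ).trans hAt) hK hdec

/-- Two kernels in a core of four represent any two core vertices, but no three. This suffices, as
no vertex outside `A` is adjacent to all of `A`; and `q = 2` turns a decomposition into a cover of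
size 4, where 5 are needed. -/
theorem hasLinearSaturation_of_isTriangleComponent {A K : Finset W} {u v w : W}
    (hT : IsTriangleComponent F K u v w) (hK : IsTwoCore F K)
    (hKmax : ∀ Y, IsTwoCore F Y → Y ⊆ K) (hAK : A ⊆ K) (hA : HitsTwoCores F A)
    (hmin : ∀ B, HitsTwoCores F B → A.card ≤ B.card) (hA3 : A.card = 3) :
    HasLinearSaturation 5 F := by
  classical
  have hrep : ∀ Q : Finset (Fin 4), Q.card ≤ 2 → ∃ σ : Fin 4 → Fin 2, Set.InjOn σ Q ∧
      ∀ a ∈ Q, a ∈ (![{0, 1, 2}, {0, 1, 3}] : Fin 2 → Finset (Fin 4)) (σ a) := by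
    have h : ∀ Q : Finset (Fin 4), Q.card ≤ 2 → ∃ σ : Fin 4 → Fin 2,
        (∀ a ∈ Q, ∀ b ∈ Q, σ a = σ b → a = b) ∧
        ∀ a ∈ Q, a ∈ (![{0, 1, 2}, {0, 1, 3}] : Fin 2 → Finset (Fin 4)) (σ a) := by decide
    intro Q hQ
    obtain ⟨σ, h1, h2⟩ := h Q hQ
    exact ⟨σ, fun a ha b hb => h1 a ha b hb, h2⟩
  refine hasLinearSaturation_of_not_petalDecomposable (k := 5) (d := 2) (s := 2) (by norm_num)
    ![{0, 1, 2}, {0, 1, 3}] (by decide) (by decide) (by norm_num) (by norm_num) hrep hA (by omega)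
    ?_ hK ?_
  · intro x hxA Q hQA hQ
    by_contra hcon
    obtain rfl : Q = A := Finset.eq_of_subset_of_card_le hQA (by omega)
    -- If `x ∈ K`, then `A` meets the triangle, so `x` and then all of `A` lie in it, leaving room
    -- for only two vertices. If not, `x` could be added to `K`.
    by_cases hxK : x ∈ K
    · obtain ⟨⟨hu, hv, hw⟩, ⟨huv, huw, hvw⟩, hiso⟩ := hT
      obtain ⟨y, hy, hyQ⟩ := hA {u, v, w} (by
        intro y hy
        simp only [Finset.mem_insert, Finset.mem_singleton] at hy
        rcases hy with rfl | rfl | rfl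
        · exact ⟨v, by simp, w, by simp, hvw.ne, huv, huw⟩
        · exact ⟨u, by simp, w, by simp, huw.ne, huv.symm, hvw⟩
        · exact ⟨u, by simp, v, by simp, huv.ne, huw.symm, hvw.symm⟩) ⟨u, by simp⟩
      simp only [Finset.mem_insert, Finset.mem_singleton] at hy
      have hx := hiso x hxK y hy (hQ y hyQ).symm
      have hsub : Q ⊆ ({u, v, w} : Finset W).erase x := by
        intro a ha
        have := hiso a (hAK ha) x hx (hQ a ha)
        simpa [(hQ a ha).ne'] using this
      have h1 := Finset.card_le_card hsub
      rw [Finset.card_erase_of_mem (by simpa using hx)] at h1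
      have := Finset.card_le_three (a := u) (b := v) (c := w)
      omega
    · refine hxK (hKmax (insert x K) ?_ (Finset.mem_insert_self _ _))
      intro y hy
      rcases Finset.mem_insert.mp hy with rfl | hy
      · obtain ⟨a, ha, b, hb, hab⟩ := Finset.one_lt_card.mp (show 1 < Q.card by omega)
        exact ⟨a, Finset.mem_insert_of_mem (hAK ha), b, Finset.mem_insert_of_mem (hAK hb), hab,
          hQ a ha, hQ b hb⟩
      · obtain ⟨a, ha, b, hb, h⟩ := hK y hy
        exact ⟨a, Finset.mem_insert_of_mem ha, b, Finset.mem_insert_of_mem hb, h⟩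
  · intro hdec
    obtain ⟨C, hC, hC4⟩ := hdec.exists_coversEdges hK (Or.inr le_rfl)
    have := hT.card_add_two_le hKmax hmin (by omega) hC
    omega

theorem hasLinearSaturation (hF : F ≠ ⊥) {k : ℕ} (hk3 : 3 ≤ k) (hk5 : k ≤ 5) :
    HasLinearSaturation k F := by
  classical
  obtain ⟨K, hK, hKmax⟩ := exists_greatest_isTwoCore F
  rcases K.eq_empty_or_nonempty with rfl | hKne
  · refine hasLinearSaturation_of_forest hF fun Y hY hne => ?_
    obtain ⟨y, hy⟩ := hne
    exact absurd (hKmax Y hY hy) (by simp)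
  obtain ⟨A, hAK, hA, hmin⟩ := exists_minimum_hitsTwoCores hKmax
  obtain ⟨C, hC, hCmin⟩ := exists_minimum_coversEdges F K
  have hA0 : 0 < A.card := by
    obtain ⟨y, -, hy⟩ := hA K hK hKne
    exact Finset.card_pos.mpr ⟨y, hy⟩
  obtain ⟨x, -, hxC⟩ : ∃ x ∈ K, x ∈ C := by
    obtain ⟨y, hy⟩ := hKne
    obtain ⟨z, hz, -, hyz⟩ := hK.exists_adj_ne hy y
    rcases hC y hy z hz hyz with h | h
    · exact ⟨y, hy, h⟩
    · exact ⟨z, hz, h⟩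
  have hCx := hC.hitsTwoCores_erase hKmax x
  have hCxcard := Finset.card_erase_add_one hxC
  have hAC := hmin _ hCx
  by_cases hA2 : A.card ≤ 2
  · refine hasLinearSaturation_of_full (r := 1) (s := k - 1) hk3 (by omega) le_rfl (by omega)
      (Or.inl rfl) hA0 hA le_rfl hK fun hdec => ?_
    obtain ⟨B, hB, hBc⟩ := hdec.exists_coversEdges hK (Or.inr hA2)
    have := hCmin B hB
    omega
  -- A cover minus one vertex hits every two-core but is too small to be a cover; `s = 1` needs `k ≤
  -- t`, which holds here.
  by_cases hkC : k + 1 ≤ C.card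
  · refine hasLinearSaturation_of_full (r := k - 1) (s := 1) (t := (C.erase x).card) hk3 (by omega)
      (by omega) one_pos (Or.inr (by omega)) (by omega) hCx le_rfl hK fun hdec => ?_
    obtain ⟨B, hB, hBc⟩ := hdec.exists_coversEdges hK (Or.inl le_rfl)
    have := hCmin B hB
    omega
  by_cases hT : ∃ u v w, IsTriangleComponent F K u v w
  · obtain ⟨u, v, w, hT⟩ := hT
    have := hT.card_add_two_le hKmax hmin (by omega) hC
    obtain rfl : k = 5 := by omega
    exact hasLinearSaturation_of_isTriangleComponent hT hK hKmax hAK hA hmin (by omega)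
  · push Not at hT
    -- Now `A.card` is 3 or 4: the first gives `q = 3`, the second forces `k = 5` and `s = 2`.
    refine hasLinearSaturation_of_full (r := A.card - 1) (s := k - (A.card - 1)) hk3 (by omega)
      (by omega) (by omega) (Or.inr (by omega)) hA0 hA le_rfl hK fun hdec => ?_
    have := hdec.two_mul_le_card hK hKmax hmin (by omega) (by
      by_cases h : A.card ≤ 3
      · exact Or.inr ⟨h, hT⟩
      · exact Or.inl (by omega)) hC
    omega

end Cases

theorem mainTheorem1 {W : Type*} [Finite W] (F : SimpleGraph W) (hF : F ≠ ⊥)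
    (k : ℕ) (hk3 : 3 ≤ k) (hk5 : k ≤ 5) :
    (∀ n : ℕ, ∃ H : UniformHypergraph k (Fin n), H.IsBergeSaturated F) ∧
      (fun n : ℕ => (bergeSat k n F : ℝ)) =O[atTop] (fun n : ℕ => (n : ℝ)) := by
  have := Fintype.ofFinite W
  constructor
  · intro n
    obtain ⟨H, -, hH⟩ := UniformHypergraph.exists_isBergeSaturated_ge (V := Fin n)
      (⟨∅, by simp⟩ : UniformHypergraph k (Fin n))
      (UniformHypergraph.not_containsBerge_of_edges_eq_empty hF rfl)
    exact ⟨H, hH⟩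
  · obtain ⟨C, n₀, h⟩ := hasLinearSaturation hF hk3 hk5
    refine IsBigO.of_bound C (eventually_atTop.mpr ⟨n₀, fun n hn => ?_⟩)
    obtain ⟨H, hH, hcard⟩ := h n hn
    have hmin : bergeSat k n F ≤ H.edges.card := Nat.sInf_le ⟨H, hH, rfl⟩
    have hle : bergeSat k n F ≤ C * n := hmin.trans hcard
    simpa using (by exact_mod_cast hle : (bergeSat k n F : ℝ) ≤ C * n)
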